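/- Let $m,n\in\mathbb{N}$, let $x_1,\dots,x_m\in\mathbb{R}^3$ be pairwise distinct, and let $$H=-\Delta\otimes I_n,\qquad \operatorname{dom}(H)=\{f\in W^2_2(\mathbb{R}^3,\mathbb{C}^n): f(x_j)=0,\ j=1,\dots,m\}$$ be the minimal Schrödinger operator in $L^2(\mathbb{R}^3,\mathbb{C}^n)$ (where $f(x_j)$ is the value of the continuous representative of $f$). Put $\mathcal H=\bigoplus_{j=1}^m\mathbb{C}^n$ and, for $f\in\operatorname{dom}(H^*)$ (represented by a function that is continuous on $\mathbb{R}^3\setminus\{x_1,\dots,x_m\}$), $$\Gamma_0f=4\pi\{\xi_{0j}\}_{j=1}^m,\quad \xi_{0j}=\lim_{x\to x_j}|x-x_j|f(x),\qquad \Gamma_1f=\Bigl\{\lim_{x\to x_j}\Bigl(f(x)-\frac{\xi_{0j}}{|x-x_j|}\Bigr)\Bigr\}_{j=1}^m .$$ These limits exist, and $\Pi=\{\mathcal H,\Gamma_0,\Gamma_1\}$ is a boundary triplet for $H^*$; that is, $H$ is closed, densely defined and symmetric, $\Gamma_0,\Gamma_1$ are linear, $$(H^*f,g)-(f,H^*g)=(\Gamma_1f,\Gamma_0g)-(\Gamma_0f,\Gamma_1g),\qquad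 f,g\in\operatorname{dom}(H^*),$$ and $(\Gamma_0,\Gamma_1):\operatorname{dom}(H^*)\to\mathcal H\oplus\mathcal H$ is surjective. Let $H_0=H^*\upharpoonright\ker\Gamma_0$, $\mathcal N_z=\ker(H^*-z)$, and for $z\in\rho(H_0)$ let $\gamma(z)=(\Gamma_0\upharpoonright\mathcal N_z)^{-1}$ and $M(z)=\Gamma_1\gamma(z)$ be the $\gamma$-field and the Weyl function of $\Pi$. Let $\sqrt z$ be the square root with $\operatorname{Im}\sqrt z>0$. Then every $z\in\mathbb{C}$ with $\operatorname{Im}z>0$ belongs to $\rho(H_0)$, and for every such $z$: (i) $M(z)=\bigoplus_{s=1}^nM_s(z)$ with respect to the $n$ components of $\mathbb{C}^n$, where $$M_s(z)=\Bigl(\frac{i\sqrt z}{4\pi}\delta_{jk}+\widetilde G_{\sqrt z}(x_j-x_k)\Bigr)_{j,k=1}^m,\qquad \widetilde G_{\sqrt z}(x)=\begin{cases}\dfrac{e^{i\sqrt z|x|}}{4\pi|x|},&x\neq0,\\[1ex]0,&x=0;\end{cases}$$ (ii) for all $\xi=\{\xi_j\}_{j=1}^m$ with $\xi_j\in\mathbb{C}^n$,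 $$(\gamma(z)\xi)(x)=\sum_{j=1}^m\xi_j\,\frac{e^{i\sqrt z|x-x_j|}}{4\pi|x-x_j|}\qquad\text{for almost every }x\in\mathbb{R}^3 .$$ -/

import Mathlib

open MeasureTheory Filter Topology
open scoped ENNReal SchwartzMap

noncomputable section

namespace PointInteraction

section Abstract

variable {𝔥 : Type*} [NormedAddCommGroup 𝔥] [InnerProductSpace ℂ 𝔥]

/-- The resolvent set of a (possibly unbounded) operator `T`: those `z` for which `T - z` maps the
domain of `T` bijectively onto the whole space, with an everywhere defined bounded inverse `R`. -/
def resolventSet (T : 𝔥 →ₗ.[ℂ] 𝔥) : Set ℂ :=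
  {z | ∃ R : 𝔥 →L[ℂ] 𝔥,
    (∀ g : 𝔥, ∃ h : R g ∈ T.domain, T ⟨R g, h⟩ - z • R g = g) ∧
    ∀ f : T.domain, R (T f - z • (f : 𝔥)) = f}

variable [CompleteSpace 𝔥]

/-- The defect subspace `𝒩_z = ker (A* - z)`, as a subspace of `dom A*`. -/
def defectSubspace (A : 𝔥 →ₗ.[ℂ] 𝔥) (z : ℂ) : Submodule ℂ A.adjoint.domain :=
  LinearMap.ker (A.adjoint.toFun - z • A.adjoint.domain.subtype)

/-- A boundary triplet `{𝓗, Γ₀, Γ₁}` for the adjoint of a densely defined closed symmetric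
operator `A`: linear maps on `dom A*` that satisfy the second Green identity and are jointly onto.
(That the deficiency indices of `A` agree is then automatic.) -/
structure BoundaryTriplet (A : 𝔥 →ₗ.[ℂ] 𝔥)
    (𝓗 : Type*) [NormedAddCommGroup 𝓗] [InnerProductSpace ℂ 𝓗] where
  dense_domain : Dense (A.domain : Set 𝔥)
  isClosed : A.IsClosed
  symmetric : A.IsFormalAdjoint A
  Γ₀ : A.adjoint.domain →ₗ[ℂ] 𝓗
  Γ₁ : A.adjoint.domain →ₗ[ℂ] 𝓗
  green : ∀ f g : A.adjoint.domain,
    inner ℂ (A.adjoint f) (g : 𝔥) - inner ℂ (f : 𝔥) (A.adjoint g) =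
      inner ℂ (Γ₁ f) (Γ₀ g) - inner ℂ (Γ₀ f) (Γ₁ g)
  surjective : Function.Surjective fun f : A.adjoint.domain => (Γ₀ f, Γ₁ f)

namespace BoundaryTriplet

variable {A : 𝔥 →ₗ.[ℂ] 𝔥} {𝓗 : Type*} [NormedAddCommGroup 𝓗] [InnerProductSpace ℂ 𝓗]

/-- The extension `A₀`, the restriction of `A*` to `ker Γ₀`. -/
def A₀ (P : BoundaryTriplet A 𝓗) : 𝔥 →ₗ.[ℂ] 𝔥 :=
  A.adjoint.domRestrict ((LinearMap.ker P.Γ₀).map A.adjoint.domain.subtype)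

/-- The restriction of `Γ₀` to `𝒩_z`. -/
def Γ₀Restrict (P : BoundaryTriplet A 𝓗) (z : ℂ) : defectSubspace A z →ₗ[ℂ] 𝓗 :=
  P.Γ₀.domRestrict (defectSubspace A z)

/-- `Γ₀` restricted to `𝒩_z` is a bijection onto `𝓗` when `z` is in the resolvent set of `A₀`. -/
theorem bijective_Γ₀Restrict (P : BoundaryTriplet A 𝓗) {z : ℂ} (hz : z ∈ resolventSet P.A₀) :
    Function.Bijective (P.Γ₀Restrict z) := by
  obtain ⟨R, hR, hR'⟩ := hz
  constructor
  · rw [injective_iff_map_eq_zero]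
    intro f hf
    have hmem : ((f : A.adjoint.domain) : 𝔥) ∈ P.A₀.domain :=
      ⟨⟨f, hf, rfl⟩, (f : A.adjoint.domain).2⟩
    have h1 : P.A₀ ⟨_, hmem⟩ = A.adjoint (f : A.adjoint.domain) :=
      LinearPMap.domRestrict_apply rfl
    have h2 : A.adjoint (f : A.adjoint.domain) - z • ((f : A.adjoint.domain) : 𝔥) = 0 := f.2
    have h3 := hR' ⟨_, hmem⟩
    rw [h1, h2, map_zero] at h3
    exact Subtype.ext (Subtype.ext h3.symm)
  · intro ξ
    obtain ⟨f, hf⟩ := P.surjective (ξ, 0)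
    have hf0 : P.Γ₀ f = ξ := congrArg Prod.fst hf
    obtain ⟨h, hg⟩ := hR (A.adjoint f - z • (f : 𝔥))
    obtain ⟨⟨u, hu, hu'⟩, -⟩ := id h
    have h1 : P.A₀ ⟨_, h⟩ = A.adjoint u := LinearPMap.domRestrict_apply hu'.symm
    rw [h1, ← hu'] at hg
    have hN : f - u ∈ defectSubspace A z := by
      have : A.adjoint (f - u) - z • ((f - u : A.adjoint.domain) : 𝔥) = 0 := by
        have hg' : A.adjoint u - z • (u : 𝔥) = A.adjoint f - z • (f : 𝔥) := hg
        rw [LinearPMap.map_sub, Submodule.coe_sub, smul_sub, sub_sub_sub_comm, hg', sub_self]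
      exact this
    refine ⟨⟨f - u, hN⟩, ?_⟩
    change P.Γ₀ (f - u) = ξ
    rw [map_sub, hf0, LinearMap.mem_ker.1 hu, sub_zero]

/-- The `γ`-field at a point `z` of the resolvent set of `A₀`: the inverse of `Γ₀` restricted
to `𝒩_z`, as a map into the Hilbert space. -/
def gammaField (P : BoundaryTriplet A 𝓗) (z : ℂ) (hz : z ∈ resolventSet P.A₀) : 𝓗 →ₗ[ℂ] 𝔥 :=
  A.adjoint.domain.subtype ∘ₗ (defectSubspace A z).subtype ∘ₗ
    (LinearEquiv.ofBijective (P.Γ₀Restrict z) (P.bijective_Γ₀Restrict hz)).symm.toLinearMap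

/-- The Weyl function `M(z) = Γ₁ γ(z)` at a point `z` of the resolvent set of `A₀`. -/
def weylFunction (P : BoundaryTriplet A 𝓗) (z : ℂ) (hz : z ∈ resolventSet P.A₀) : 𝓗 →ₗ[ℂ] 𝓗 :=
  P.Γ₁ ∘ₗ (defectSubspace A z).subtype ∘ₗ
    (LinearEquiv.ofBijective (P.Γ₀Restrict z) (P.bijective_Γ₀Restrict hz)).symm.toLinearMap

end BoundaryTriplet

end Abstract

/-- The space `ℝ³`. -/
abbrev Space : Type := EuclideanSpace ℝ (Fin 3)

/-- The Hilbert space `L²(ℝ³, ℂⁿ)`. -/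
abbrev L2 (n : ℕ) : Type := Lp (EuclideanSpace ℂ (Fin n)) 2 (volume : Measure Space)

/-- The boundary space `⊕_{j=1}^m ℂⁿ`. -/
abbrev BoundarySpace (m n : ℕ) : Type := PiLp 2 fun _ : Fin m => EuclideanSpace ℂ (Fin n)

open scoped Laplacian

/-- The Sobolev space `W²₂(ℝ³, ℂⁿ)`, as a subspace of `L²(ℝ³, ℂⁿ)`. -/
def W22 (n : ℕ) : Submodule ℂ (L2 n) where
  carrier := {f | TemperedDistribution.MemSobolev 2 2
    (f : 𝓢'(Space, EuclideanSpace ℂ (Fin n)))}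
  zero_mem' := by
    change TemperedDistribution.MemSobolev 2 2 _
    rw [← Lp.toTemperedDistributionCLM_apply, map_zero]
    exact TemperedDistribution.memSobolev_fun_zero _ _ 2 2
  add_mem' {f g} hf hg := by
    change TemperedDistribution.MemSobolev 2 2 _
    rw [← Lp.toTemperedDistributionCLM_apply, map_add]
    exact TemperedDistribution.MemSobolev.add hf hg
  smul_mem' c f hf := by
    change TemperedDistribution.MemSobolev 2 2 _
    rw [← Lp.toTemperedDistributionCLM_apply, map_smul]
    exact TemperedDistribution.MemSobolev.smul c hf

/-- The distributional Laplacian of a `W²₂` function is an `L²` function. -/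
theorem exists_neg_laplacian {n : ℕ} (f : W22 n) :
    ∃ g : L2 n, (g : 𝓢'(Space, EuclideanSpace ℂ (Fin n))) =
      -Δ ((f : L2 n) : 𝓢'(Space, EuclideanSpace ℂ (Fin n))) := by
  have h := TemperedDistribution.MemSobolev.laplacian (s := 2) f.2
  rw [sub_self, TemperedDistribution.memSobolev_zero_iff] at h
  obtain ⟨g, hg⟩ := h
  refine ⟨-g, ?_⟩
  rw [hg, ← Lp.toTemperedDistributionCLM_apply, ← Lp.toTemperedDistributionCLM_apply, map_neg]

/-- An `L²` function is determined by the distribution it defines. -/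
theorem toTemperedDistribution_inj {n : ℕ} {f g : L2 n}
    (h : (f : 𝓢'(Space, EuclideanSpace ℂ (Fin n))) = g) : f = g := by
  rw [← Lp.toTemperedDistributionCLM_apply, ← Lp.toTemperedDistributionCLM_apply] at h
  exact LinearMap.ker_eq_bot.1 (Lp.ker_toTemperedDistributionCLM_eq_bot
    (F := EuclideanSpace ℂ (Fin n)) (μ := (volume : Measure Space)) (p := 2)) h

/-- `-Δ f` as an `L²` function, for `f` in `W²₂`. -/
def negLaplacianFun {n : ℕ} (f : W22 n) : L2 n := (exists_neg_laplacian f).choose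

theorem negLaplacianFun_spec {n : ℕ} (f : W22 n) :
    Lp.toTemperedDistributionCLM (EuclideanSpace ℂ (Fin n)) (volume : Measure Space) 2
        (negLaplacianFun f) =
      -LineDeriv.laplacianCLM ℂ Space 𝓢'(Space, EuclideanSpace ℂ (Fin n))
        (Lp.toTemperedDistributionCLM (EuclideanSpace ℂ (Fin n)) (volume : Measure Space) 2
          (f : L2 n)) := by
  rw [TemperedDistribution.laplacianCLM_apply]
  exact (exists_neg_laplacian f).choose_spec

/-- The operator `-Δ ⊗ I_n` from `W²₂(ℝ³, ℂⁿ)` to `L²(ℝ³, ℂⁿ)`, in the sense of distributions. -/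
def negLaplacian (n : ℕ) : W22 n →ₗ[ℂ] L2 n where
  toFun f := negLaplacianFun f
  map_add' f g := by
    apply toTemperedDistribution_inj
    rw [← Lp.toTemperedDistributionCLM_apply, ← Lp.toTemperedDistributionCLM_apply, map_add]
    simp only [negLaplacianFun_spec, Submodule.coe_add, map_add, neg_add]
  map_smul' c f := by
    apply toTemperedDistribution_inj
    rw [← Lp.toTemperedDistributionCLM_apply, ← Lp.toTemperedDistributionCLM_apply, map_smul]
    simp only [negLaplacianFun_spec, Submodule.coe_smul, map_smul, RingHom.id_apply, smul_neg]

variable {m n : ℕ}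

/-- The domain of the minimal operator: all `f ∈ W²₂(ℝ³, ℂⁿ)` whose continuous representative
vanishes at the points `x_j`. -/
def minimalDomain (n : ℕ) (x : Fin m → Space) : Submodule ℂ (L2 n) where
  carrier := {f | f ∈ W22 n ∧ ∃ u : Space → EuclideanSpace ℂ (Fin n),
    Continuous u ∧ f =ᵐ[volume] u ∧ ∀ j, u (x j) = 0}
  zero_mem' := ⟨zero_mem _, 0, continuous_zero, Lp.coeFn_zero _ _ _, fun _ => rfl⟩
  add_mem' := by
    rintro f g ⟨hf, u, hu, hfu, hux⟩ ⟨hg, v, hv, hgv, hvx⟩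
    refine ⟨add_mem hf hg, u + v, hu.add hv, (Lp.coeFn_add f g).trans (hfu.add hgv), fun j => ?_⟩
    rw [Pi.add_apply, hux, hvx, add_zero]
  smul_mem' := by
    rintro c f ⟨hf, u, hu, hfu, hux⟩
    refine ⟨Submodule.smul_mem _ c hf, c • u, hu.const_smul c,
      (Lp.coeFn_smul c f).trans (hfu.const_smul c), fun j => ?_⟩
    rw [Pi.smul_apply, hux, smul_zero]

theorem minimalDomain_le (n : ℕ) (x : Fin m → Space) : minimalDomain n x ≤ W22 n :=
  fun _ hf => hf.1

/-- The minimal Schrödinger operator `H = -Δ ⊗ I_n` in `L²(ℝ³, ℂⁿ)`. -/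
def minimalOperator (n : ℕ) (x : Fin m → Space) : L2 n →ₗ.[ℂ] L2 n where
  domain := minimalDomain n x
  toFun := negLaplacian n ∘ₗ Submodule.inclusion (minimalDomain_le n x)

/-- `h₀` and `h₁` are the boundary values of `f` at the points `x_j`: with `u` the representative
of `f` that is continuous away from these points, and
`ξ_{0j} = lim_{y → x_j} |y - x_j| u(y)`, one has `h_{0j} = 4π ξ_{0j}` and
`h_{1j} = lim_{y → x_j} (u(y) - ξ_{0j} / |y - x_j|)`. -/
def HasBoundaryValues (x : Fin m → Space) (f : L2 n) (h₀ h₁ : BoundarySpace m n) : Prop :=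
  ∃ u : Space → EuclideanSpace ℂ (Fin n),
    f =ᵐ[volume] u ∧ ContinuousOn u (Set.range x)ᶜ ∧
    ∃ ξ₀ : Fin m → EuclideanSpace ℂ (Fin n), ∀ j,
      Tendsto (fun y => ‖y - x j‖ • u y) (𝓝[≠] x j) (𝓝 (ξ₀ j)) ∧
      h₀ j = (4 * Real.pi) • ξ₀ j ∧
      Tendsto (fun y => u y - ‖y - x j‖⁻¹ • ξ₀ j) (𝓝[≠] x j) (𝓝 (h₁ j))

/-- The boundary triplet with `Γ₀` and `Γ₁` given by the boundary values at the points `x_j`. -/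
def IsPointTriplet (x : Fin m → Space)
    (P : BoundaryTriplet (minimalOperator n x) (BoundarySpace m n)) : Prop :=
  ∀ f : (minimalOperator n x).adjoint.domain, HasBoundaryValues x (f : L2 n) (P.Γ₀ f) (P.Γ₁ f)

/-- The branch of the square root on `ℂ \ [0, ∞)` with values in the upper half-plane. -/
def sqrtUpper (z : ℂ) : ℂ := Complex.I * (-z) ^ (1 / 2 : ℂ)

/-- `e^{i √z |y|} / (4π |y|)` for `y ≠ 0`, and `0` for `y = 0`. -/
def greenTilde (z : ℂ) (y : Space) : ℂ :=
  if y = 0 then 0 else Complex.exp (Complex.I * sqrtUpper z * ‖y‖) / (4 * Real.pi * ‖y‖)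

/-- The `m × m` matrix `M_s(z)` (the same for every `s`). -/
def weylBlock (x : Fin m → Space) (z : ℂ) : Matrix (Fin m) (Fin m) ℂ :=
  Matrix.of fun j k =>
    Complex.I * sqrtUpper z / (4 * Real.pi) * (if j = k then 1 else 0) + greenTilde z (x j - x k)

end PointInteraction

end

/-! Put κ = -i√z, so that Re κ > 0 and z = -κ². The Yukawa potential G_κ(y) = e^{-κ|y|}/(4π|y|) has
Fourier transform 1/(4π²|ξ|² + κ²) (`fourier_yukawa`). By Plancherel, pairing (-Δ + κ̄²)f with G_κ(·
- x)a therefore returns the value of f at x paired with a (`inner_greenFun`).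

Since -Δ + 1 maps W²₂ bijectively onto L², the range of H + 1 is exactly the orthogonal complement
of the Green functions at κ = 1 centred at the points x_j. These span a finite-dimensional, hence
closed, space. Closedness and density of H follow, as does the decomposition of dom H* into W²₂ plus
superpositions of Green functions (`exists_eq_add_greenMap`).

Near its centre, G_κ is 1/(4π|y|) - κ/(4π) + o(1). So f + ∑ G_κ(· - x_j)ξ_j with f in W²₂ has
boundary values ξ and f(x_j) plus the Weyl matrix applied to ξ (`hasBoundaryValues_add_greenMap`).
At κ = 1 the matrix is Hermitian, which together with the reproducing property gives Green's
identity. Surjectivity holds because values at distinct points can be prescribed in W²₂.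

Finally ker Γ₀ is W²₂, so H₀ is the free Laplacian, whose resolvent at -κ² is a bounded Fourier
multiplier. The superposition of G_κ with coefficients ξ lies in 𝒩_z and has Γ₀ equal to ξ, so it is
γ(z)ξ. Its Γ₁ is M(z)ξ. -/

noncomputable section

namespace PointInteraction

/-! ### The Yukawa potential and its Fourier transform -/

section Yukawa

open Real FourierTransform

/-- The Yukawa potential `e^{-κ|y|} / (4π|y|)`. -/
def yukawa (κ : ℂ) (y : Space) : ℂ := Complex.exp (-κ * ‖y‖) / (4 * π * ‖y‖)

theorem norm_yukawa (κ : ℂ) (y : Space) :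
    ‖yukawa κ y‖ = rexp (-κ.re * ‖y‖) / (4 * π * ‖y‖) := by
  rw [yukawa, norm_div, Complex.norm_exp]
  congr 1
  · simp
  · simp [abs_of_pos pi_pos]

theorem measurable_yukawa (κ : ℂ) : Measurable (yukawa κ) := by
  unfold yukawa
  fun_prop

theorem integrable_yukawa {κ : ℂ} (hκ : 0 < κ.re) : Integrable (yukawa κ) := by
  rw [← integrable_norm_iff (measurable_yukawa κ).aestronglyMeasurable]
  simp_rw [norm_yukawa]
  rw [integrable_fun_norm_addHaar volume (f := fun r : ℝ => rexp (-κ.re * r) / (4 * π * r))]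
  have h := (integrableOn_rpow_mul_exp_neg_mul_rpow (p := 1) (s := 1) (b := κ.re)
    (by norm_num) one_pos hκ).const_mul (4 * π)⁻¹
  refine IntegrableOn.congr_fun h (fun r hr => ?_) measurableSet_Ioi
  have hr : (0 : ℝ) < r := hr
  simp only [Real.rpow_one, finrank_euclideanSpace, Fintype.card_fin, smul_eq_mul]
  field_simp

/-- In dimension three the radial Jacobian r² cancels the squared singularity r⁻² exactly, leaving
an exponential. -/
theorem memLp_yukawa {κ : ℂ} (hκ : 0 < κ.re) : MemLp (yukawa κ) 2 := by
  rw [memLp_two_iff_integrable_sq_norm (measurable_yukawa κ).aestronglyMeasurable]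
  simp_rw [norm_yukawa]
  rw [integrable_fun_norm_addHaar volume
    (f := fun r : ℝ => (rexp (-κ.re * r) / (4 * π * r)) ^ 2)]
  have h := (exp_neg_integrableOn_Ioi 0 (b := 2 * κ.re) (by positivity)).const_mul
    ((4 * π)⁻¹ ^ 2)
  refine IntegrableOn.congr_fun h (fun r hr => ?_) measurableSet_Ioi
  have hr : (0 : ℝ) < r := hr
  have : rexp (-(2 * κ.re) * r) = rexp (-κ.re * r) ^ 2 := by
    rw [← Real.exp_nat_mul]; congr 1; push_cast; ring
  simp only [finrank_euclideanSpace, Fintype.card_fin, smul_eq_mul, this]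
  field_simp

/-- The splitting of `ℝ³` into an axis and the orthogonal plane. -/
def axisEquiv : ℝ × EuclideanSpace ℝ (Fin 2) ≃ᵐ Space :=
  ((MeasurableEquiv.refl ℝ).prodCongr (MeasurableEquiv.toLp 2 (Fin 2 → ℝ)).symm).trans
    ((MeasurableEquiv.piFinSuccAbove (fun _ : Fin 3 => ℝ) 0).symm.trans
      (MeasurableEquiv.toLp 2 (Fin 3 → ℝ)))

theorem measurePreserving_axisEquiv : MeasurePreserving axisEquiv := by
  have h1 : MeasurePreserving ((MeasurableEquiv.refl ℝ).prodCongr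
      (MeasurableEquiv.toLp 2 (Fin 2 → ℝ)).symm) :=
    (MeasurePreserving.id volume).prod (PiLp.volume_preserving_ofLp (Fin 2))
  have h2 := (volume_preserving_piFinSuccAbove (fun _ : Fin 3 => ℝ) 0).symm
  exact ((PiLp.volume_preserving_toLp (Fin 3)).comp h2).comp h1

theorem axisEquiv_apply_zero (s : ℝ) (y : EuclideanSpace ℝ (Fin 2)) : axisEquiv (s, y) 0 = s := rfl

theorem axisEquiv_apply_succ (s : ℝ) (y : EuclideanSpace ℝ (Fin 2)) (i : Fin 2) :
    axisEquiv (s, y) i.succ = y i := rfl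

theorem norm_axisEquiv (s : ℝ) (y : EuclideanSpace ℝ (Fin 2)) :
    ‖axisEquiv (s, y)‖ = √(s ^ 2 + ‖y‖ ^ 2) := by
  rw [EuclideanSpace.norm_eq, Fin.sum_univ_succ, EuclideanSpace.norm_sq_eq]
  simp only [axisEquiv_apply_succ, axisEquiv_apply_zero, norm_eq_abs, sq_abs]

/-- In plane polar coordinates the integrand is an exact derivative, since ρ/√(s² + ρ²) is the
derivative of √(s² + ρ²). This reduces the three-dimensional Fourier integral to a one-dimensional
one. -/
theorem integral_plane_yukawa {κ : ℂ} (hκ : 0 < κ.re) {s : ℝ} (hs : s ≠ 0) :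
    ∫ y, yukawa κ (axisEquiv (s, y)) = Complex.exp (-κ * |s|) / (2 * κ) := by
  have hκ0 : κ ≠ 0 := by rintro rfl; simp at hκ
  have hpos : ∀ ρ : ℝ, 0 < s ^ 2 + ρ ^ 2 := fun ρ => by positivity
  have hder : ∀ ρ : ℝ, HasDerivAt (fun ρ : ℝ => -Complex.exp (-κ * √(s ^ 2 + ρ ^ 2)) / (4 * π * κ))
      (ρ • (Complex.exp (-κ * √(s ^ 2 + ρ ^ 2)) / (4 * π * √(s ^ 2 + ρ ^ 2)))) ρ := by
    intro ρ
    have h1 : HasDerivAt (fun ρ : ℝ => √(s ^ 2 + ρ ^ 2)) (ρ / √(s ^ 2 + ρ ^ 2)) ρ := by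
      have h0 : HasDerivAt (fun ρ : ℝ => s ^ 2 + ρ ^ 2) (2 * ρ) ρ := by
        simpa using (hasDerivAt_pow 2 ρ).const_add (s ^ 2)
      convert! h0.sqrt (hpos ρ).ne' using 1
      field_simp
    have h2 := (((h1.ofReal_comp).const_mul (-κ)).cexp.neg).div_const (4 * π * κ)
    convert! h2 using 1
    have : (√(s ^ 2 + ρ ^ 2) : ℂ) ≠ 0 := by
      exact_mod_cast (Real.sqrt_pos.2 (hpos ρ)).ne'
    have hpi : (π : ℂ) ≠ 0 := by exact_mod_cast pi_ne_zero
    rw [Complex.real_smul]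
    push_cast
    field_simp
  have hint : IntegrableOn (fun ρ : ℝ => ρ •
      (Complex.exp (-κ * √(s ^ 2 + ρ ^ 2)) / (4 * π * √(s ^ 2 + ρ ^ 2)))) (Set.Ioi 0) := by
    have h := (exp_neg_integrableOn_Ioi 0 hκ).const_mul (4 * π)⁻¹
    refine Integrable.mono' h (by fun_prop) ?_
    refine (ae_restrict_iff' measurableSet_Ioi).2 (ae_of_all _ fun ρ hρ => ?_)
    have hρ : (0 : ℝ) < ρ := hρ
    have hle : ρ ≤ √(s ^ 2 + ρ ^ 2) := Real.le_sqrt_of_sq_le (by nlinarith [sq_nonneg s])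
    have hs0 := Real.sqrt_pos.2 (hpos ρ)
    rw [norm_smul, norm_div, Complex.norm_exp]
    have e1 : (-κ * (√(s ^ 2 + ρ ^ 2) : ℂ)).re = -κ.re * √(s ^ 2 + ρ ^ 2) := by simp
    have e2 : ‖(4 * π * √(s ^ 2 + ρ ^ 2) : ℂ)‖ = 4 * π * √(s ^ 2 + ρ ^ 2) := by
      simp [abs_of_pos pi_pos]
    rw [e1, e2, norm_of_nonneg hρ.le]
    have e3 : rexp (-κ.re * √(s ^ 2 + ρ ^ 2)) ≤ rexp (-κ.re * ρ) := by
      apply Real.exp_le_exp.2; nlinarith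
    calc ρ * (rexp (-κ.re * √(s ^ 2 + ρ ^ 2)) / (4 * π * √(s ^ 2 + ρ ^ 2)))
        = (4 * π)⁻¹ * ((ρ / √(s ^ 2 + ρ ^ 2)) * rexp (-κ.re * √(s ^ 2 + ρ ^ 2))) := by
          field_simp
      _ ≤ (4 * π)⁻¹ * (1 * rexp (-κ.re * ρ)) := by
          gcongr
          exact (div_le_one hs0).2 hle
      _ = _ := by rw [one_mul]
  have hlim : Tendsto (fun ρ : ℝ => -Complex.exp (-κ * √(s ^ 2 + ρ ^ 2)) / (4 * π * κ)) atTop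
      (𝓝 0) := by
    have h0 : Tendsto (fun ρ : ℝ => Complex.exp (-κ * √(s ^ 2 + ρ ^ 2))) atTop (𝓝 0) := by
      rw [tendsto_zero_iff_norm_tendsto_zero]
      have hb : Tendsto (fun ρ : ℝ => rexp (-(κ.re * ρ))) atTop (𝓝 0) :=
        Real.tendsto_exp_neg_atTop_nhds_zero.comp (tendsto_id.const_mul_atTop hκ)
      refine squeeze_zero' (Eventually.of_forall fun _ => norm_nonneg _) ?_ hb
      filter_upwards [eventually_gt_atTop 0] with ρ hρ
      rw [Complex.norm_exp]
      apply Real.exp_le_exp.2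
      have hle : ρ ≤ √(s ^ 2 + ρ ^ 2) := Real.le_sqrt_of_sq_le (by nlinarith [sq_nonneg s])
      simp
      nlinarith
    simpa using h0.neg.div_const (4 * π * κ)
  have hFTC := integral_Ioi_of_hasDerivAt_of_tendsto (hder 0).continuousAt.continuousWithinAt
    (fun ρ _ => hder ρ) hint hlim
  -- The radial formula contributes the dimension 2 times the area π of the unit disc, turning
  -- 1/(4πκ) into 1/(2κ).
  have hrad := integral_fun_norm_addHaar (volume : Measure (EuclideanSpace ℝ (Fin 2)))
    (fun ρ : ℝ => Complex.exp (-κ * √(s ^ 2 + ρ ^ 2)) / (4 * π * √(s ^ 2 + ρ ^ 2)))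
  have hball : (volume : Measure (EuclideanSpace ℝ (Fin 2))).real (Metric.ball 0 1) = π := by
    rw [Measure.real, EuclideanSpace.volume_ball]
    simp [show (1 : ℝ) + 1 = 2 by norm_num, pi_pos.le]
  simp only [finrank_euclideanSpace, Fintype.card_fin, hball, Nat.add_one_sub_one, pow_one,
    hFTC] at hrad
  have hfun : ∀ y, yukawa κ (axisEquiv (s, y)) =
      Complex.exp (-κ * √(s ^ 2 + ‖y‖ ^ 2)) / (4 * π * √(s ^ 2 + ‖y‖ ^ 2)) := fun y => by
    rw [yukawa, norm_axisEquiv]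
  simp_rw [hfun]
  rw [hrad]
  have hpi : (π : ℂ) ≠ 0 := by exact_mod_cast pi_ne_zero
  simp only [ne_eq, OfNat.ofNat_ne_zero, not_false_eq_true, zero_pow, add_zero, Real.sqrt_sq_eq_abs,
    zero_sub, Complex.real_smul, nsmul_eq_mul, Nat.cast_ofNat]
  field_simp
  norm_num

theorem integral_exp_mul_exp_abs {κ : ℂ} (hκ : 0 < κ.re) (t : ℝ) :
    ∫ s : ℝ, Complex.exp (((-2 * π * (s * t) : ℝ) : ℂ) * Complex.I) *
      (Complex.exp (-κ * |s|) / (2 * κ)) = ((2 * π * t) ^ 2 + κ ^ 2)⁻¹ := by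
  have hκ0 : κ ≠ 0 := by rintro rfl; simp at hκ
  -- `a` and `b` are the exponential rates on the positive and the negative half-line; the integral
  -- is (b⁻¹ - a⁻¹)/(2κ).
  set a : ℂ := -κ - 2 * π * t * Complex.I with ha
  set b : ℂ := κ - 2 * π * t * Complex.I with hb
  have hare : a.re < 0 := by simp [ha, hκ]
  have hbre : 0 < b.re := by simp [hb, hκ]
  have h1 : Set.EqOn (fun s : ℝ => Complex.exp (((-2 * π * (s * t) : ℝ) : ℂ) * Complex.I) *
      (Complex.exp (-κ * |s|) / (2 * κ))) (fun s : ℝ => (2 * κ)⁻¹ * Complex.exp (a * s))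
      (Set.Ioi 0) := by
    intro s hs
    have hs : (0 : ℝ) < s := hs
    simp only [abs_of_pos hs]
    rw [mul_div_assoc', ← Complex.exp_add, div_eq_inv_mul]
    congr 2
    rw [ha]; push_cast; ring
  have h2 : Set.EqOn (fun s : ℝ => Complex.exp (((-2 * π * (s * t) : ℝ) : ℂ) * Complex.I) *
      (Complex.exp (-κ * |s|) / (2 * κ))) (fun s : ℝ => (2 * κ)⁻¹ * Complex.exp (b * s))
      (Set.Iic 0) := by
    intro s hs
    have hs : s ≤ 0 := hs
    simp only [abs_of_nonpos hs]
    rw [mul_div_assoc', ← Complex.exp_add, div_eq_inv_mul]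
    congr 2
    rw [hb]; push_cast; ring
  have i1 := IntegrableOn.congr_fun ((integrableOn_exp_mul_complex_Ioi hare 0).const_mul (2 * κ)⁻¹)
    h1.symm measurableSet_Ioi
  have i2 := IntegrableOn.congr_fun ((integrableOn_exp_mul_complex_Iic hbre 0).const_mul (2 * κ)⁻¹)
    h2.symm measurableSet_Iic
  rw [← intervalIntegral.integral_Iic_add_Ioi i2 i1, setIntegral_congr_fun measurableSet_Iic h2,
    setIntegral_congr_fun measurableSet_Ioi h1, integral_const_mul, integral_const_mul,
    integral_exp_mul_complex_Ioi hare, integral_exp_mul_complex_Iic hbre]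
  have ha0 : a ≠ 0 := by intro h; simp [h] at hare
  have hb0 : b ≠ 0 := by intro h; simp [h] at hbre
  have hab : (2 * π * t) ^ 2 + κ ^ 2 = -(a * b) := by
    rw [ha, hb]; ring_nf; rw [Complex.I_sq]; ring
  have hab2 : a - b = -(2 * κ) := by rw [ha, hb]; ring
  rw [hab]
  simp only [Complex.ofReal_zero, mul_zero, Complex.exp_zero]
  field_simp
  linear_combination -hab2

/-- The potential is rotation invariant, so its Fourier transform need only be computed at
frequencies on the first axis. -/
theorem exists_linearIsometryEquiv_axis (ξ : Space) :
    ∃ A : Space ≃ₗᵢ[ℝ] Space, A ξ = EuclideanSpace.single 0 ‖ξ‖ := by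
  by_cases hξ : ξ = 0
  · exact ⟨LinearIsometryEquiv.refl ℝ _, by ext i; simp [hξ]⟩
  · have hn : ‖ξ‖ ≠ 0 := norm_ne_zero_iff.2 hξ
    obtain ⟨b, hb⟩ := Orthonormal.exists_orthonormalBasis_extension_of_card_eq (𝕜 := ℝ)
      (E := Space) (ι := Fin 3) (by simp) (v := fun _ => ‖ξ‖⁻¹ • ξ) (s := {0}) (by
        rw [orthonormal_iff_ite]
        rintro ⟨i, rfl⟩ ⟨j, rfl⟩
        simp only [Set.domRestrict, if_true]
        rw [real_inner_smul_left, real_inner_smul_right, real_inner_self_eq_norm_sq]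
        field_simp)
    refine ⟨b.repr, ?_⟩
    have h0 : ξ = ‖ξ‖ • b 0 := by rw [hb 0 rfl, smul_smul, mul_inv_cancel₀ hn, one_smul]
    conv_lhs => rw [h0]
    rw [map_smul, b.repr_self]
    ext i
    simp

theorem fourier_yukawa {κ : ℂ} (hκ : 0 < κ.re) (ξ : Space) :
    𝓕 (yukawa κ) ξ = (((2 * π * ‖ξ‖) ^ 2 : ℝ) + κ ^ 2 : ℂ)⁻¹ := by
  obtain ⟨A, hA⟩ := exists_linearIsometryEquiv_axis ξ
  have hcomp : yukawa κ ∘ A = yukawa κ := by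
    ext y; simp [yukawa]
  rw [← hcomp, Real.fourier_comp_linearIsometry, hA, Real.fourier_eq',
    ← measurePreserving_axisEquiv.integral_comp axisEquiv.measurableEmbedding,
    Measure.volume_eq_prod, integral_prod]
  · have hin : ∀ (s : ℝ) (y : EuclideanSpace ℝ (Fin 2)),
        inner ℝ (axisEquiv (s, y)) (EuclideanSpace.single 0 ‖ξ‖) = s * ‖ξ‖ := by
      intro s y
      rw [EuclideanSpace.inner_single_right, axisEquiv_apply_zero]
      simp [mul_comm]
    simp_rw [hin, integral_smul]
    -- The plane integral was evaluated only for s ≠ 0; the excluded slice is null.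
    have hae : ∀ᵐ s : ℝ, s ≠ 0 := by simp [ae_iff]
    rw [integral_congr_ae (g := fun s : ℝ =>
      Complex.exp (((-2 * π * (s * ‖ξ‖) : ℝ) : ℂ) * Complex.I) *
        (Complex.exp (-κ * |s|) / (2 * κ))), integral_exp_mul_exp_abs hκ]
    · push_cast; rfl
    · filter_upwards [hae] with s hs
      rw [integral_plane_yukawa hκ hs, smul_eq_mul]
  · rw [← Measure.volume_eq_prod]
    refine (measurePreserving_axisEquiv.integrable_comp_emb axisEquiv.measurableEmbedding
      (g := fun v : Space => Complex.exp (((-2 * π * inner ℝ v (EuclideanSpace.single 0 ‖ξ‖) : ℝ) : ℂ)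
        * Complex.I) • yukawa κ v)).2 ?_
    refine (integrable_yukawa hκ).bdd_mul (c := 1) (by fun_prop) (ae_of_all _ fun v => ?_)
    rw [Complex.norm_exp_ofReal_mul_I]

end Yukawa

/-! ### Fourier transform on L² versus the Fourier integral -/

section L2Fourier

open FourierTransform

variable {V F : Type*} [NormedAddCommGroup V] [InnerProductSpace ℝ V] [FiniteDimensional ℝ V]
  [MeasurableSpace V] [BorelSpace V] [NormedAddCommGroup F]

theorem locallyIntegrable_Lp (f : Lp F 2 (volume : Measure V)) : LocallyIntegrable f :=
  (Lp.memLp f).locallyIntegrable (by norm_num)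

variable [InnerProductSpace ℂ F]

theorem continuous_fourier_of_integrable {f : V → F} (hf : Integrable f) : Continuous (𝓕 f) :=
  VectorFourier.fourierIntegral_continuous Real.continuous_fourierChar continuous_inner hf

theorem continuous_fourierInv_of_integrable {f : V → F} (hf : Integrable f) :
    Continuous (𝓕⁻ f) := by
  rw [Real.fourierInv_eq_fourier_comp_neg f]
  exact continuous_fourier_of_integrable hf.comp_neg

variable [CompleteSpace F]

/-- Real smooth compactly supported functions, viewed as complex-valued, are Schwartz functions and
already separate locally integrable functions. -/
theorem ae_eq_of_integral_schwartz_smul_eq {f g : V → F} (hf : LocallyIntegrable f)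
    (hg : LocallyIntegrable g) (h : ∀ φ : 𝓢(V, ℂ), ∫ x, φ x • f x = ∫ x, φ x • g x) :
    f =ᵐ[volume] g := by
  refine ae_eq_of_integral_contDiff_smul_eq hf hg fun φ hφ hφc => ?_
  have h1 : HasCompactSupport (Complex.ofRealCLM ∘ φ) := hφc.comp_left rfl
  have h2 : ContDiff ℝ (⊤ : ℕ∞) (Complex.ofRealCLM ∘ φ) := by fun_prop
  simpa using h (h1.toSchwartzMap h2)

/-- An `L²` function represents the product of a function of temperate growth with another `L²`
function in the sense of distributions iff it does so almost everywhere. -/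
theorem toTemperedDistribution_eq_smulLeftCLM_iff {g : V → ℂ} (hg : g.HasTemperateGrowth)
    (f h : Lp F 2 (volume : Measure V)) :
    (h : 𝓢'(V, F)) = TemperedDistribution.smulLeftCLM F g f ↔
      h =ᵐ[volume] fun x => g x • f x := by
  have hgc : Continuous g := hg.1.continuous
  have hloc : LocallyIntegrable (fun x => g x • f x) := by
    exact (locallyIntegrable_Lp f).continuous_smul hgc
  have hval : ∀ φ : 𝓢(V, ℂ), TemperedDistribution.smulLeftCLM F g (f : 𝓢'(V, F)) φ =
      ∫ x, φ x • (g x • f x) := by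
    intro φ
    rw [TemperedDistribution.smulLeftCLM_apply_apply, Lp.toTemperedDistribution_apply]
    refine integral_congr_ae (ae_of_all _ fun x => ?_)
    simp [SchwartzMap.smulLeftCLM_apply_apply hg, smul_smul, mul_comm]
  constructor
  · intro H
    refine ae_eq_of_integral_schwartz_smul_eq (locallyIntegrable_Lp h) hloc fun φ => ?_
    rw [← hval, ← H, Lp.toTemperedDistribution_apply]
  · intro H
    ext φ
    rw [hval, Lp.toTemperedDistribution_apply]
    refine integral_congr_ae ?_
    filter_upwards [H] with x hx
    rw [hx]

theorem integral_fourier_schwartz_smul (φ : 𝓢(V, ℂ)) {f : V → F} (hf : Integrable f) :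
    ∫ x, (𝓕 φ : 𝓢(V, ℂ)) x • f x = ∫ x, φ x • 𝓕 f x := by
  have h := VectorFourier.integral_fourierIntegral_smul_eq_flip (L := innerₗ V) (f := φ) (g := f)
    Real.continuous_fourierChar continuous_inner (φ.integrable (μ := volume)) hf
  rw [flip_innerₗ] at h
  exact h

theorem integral_fourierInv_schwartz_smul (φ : 𝓢(V, ℂ)) {f : V → F} (hf : Integrable f) :
    ∫ x, (𝓕⁻ φ : 𝓢(V, ℂ)) x • f x = ∫ x, φ x • 𝓕⁻ f x := by
  have h := integral_fourier_schwartz_smul φ hf.comp_neg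
  simp only [Real.fourierInv_eq_fourier_comp_neg f]
  rw [← h, ← integral_neg_eq_self]
  refine integral_congr_ae (ae_of_all _ fun x => ?_)
  simp only [SchwartzMap.fourierInv_coe, SchwartzMap.fourier_coe, Real.fourierInv_eq_fourier_neg,
    neg_neg]

/-- On `L¹ ∩ L²` the Fourier transform is given by the Fourier integral. -/
theorem coeFn_fourier_of_integrable (f : Lp F 2 (volume : Measure V)) (hf : Integrable f) :
    (𝓕 f : Lp F 2 (volume : Measure V)) =ᵐ[volume] 𝓕 (f : V → F) := by
  refine ae_eq_of_integral_schwartz_smul_eq (locallyIntegrable_Lp _)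
    (continuous_fourier_of_integrable hf).locallyIntegrable fun φ => ?_
  rw [← integral_fourier_schwartz_smul φ hf, ← Lp.toTemperedDistribution_apply,
    ← Lp.toTemperedDistribution_apply, ← Lp.fourier_toTemperedDistribution_eq,
    TemperedDistribution.fourier_apply]

/-- On `L¹ ∩ L²` the inverse Fourier transform is given by the inverse Fourier integral. -/
theorem coeFn_fourierInv_of_integrable (f : Lp F 2 (volume : Measure V)) (hf : Integrable f) :
    (𝓕⁻ f : Lp F 2 (volume : Measure V)) =ᵐ[volume] 𝓕⁻ (f : V → F) := by
  refine ae_eq_of_integral_schwartz_smul_eq (locallyIntegrable_Lp _)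
    (continuous_fourierInv_of_integrable hf).locallyIntegrable fun φ => ?_
  rw [← integral_fourierInv_schwartz_smul φ hf, ← Lp.toTemperedDistribution_apply,
    ← Lp.toTemperedDistribution_apply, ← Lp.fourierInv_toTemperedDistribution_eq,
    TemperedDistribution.fourierInv_apply]

end L2Fourier

/-! ### The free Laplacian as a Fourier multiplier; reproducing property of Green functions -/

section FreeOperator

open FourierTransform Real
open scoped Laplacian

variable {n : ℕ}

theorem add_smul_self {W : Type*} [AddCommGroup W] [Module ℂ W] (c : ℂ) (v : W) :
    v + c • v = (1 + c) • v := by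
  rw [add_smul, one_smul]

/-- The Fourier symbol of `-Δ`. -/
def symbol (ξ : Space) : ℝ := (2 * π * ‖ξ‖) ^ 2

theorem continuous_symbol : Continuous symbol := by
  unfold symbol
  fun_prop

theorem hasTemperateGrowth_symbol : (fun ξ => (symbol ξ : ℂ)).HasTemperateGrowth := by
  have h : (fun ξ : Space => (symbol ξ : ℂ)) =
      fun ξ => ((2 * π) ^ 2 : ℂ) * Complex.ofReal (‖ξ‖ ^ 2) := by
    ext ξ; simp [symbol, mul_pow]
  rw [h]
  fun_prop

/-- Turns the distributional equation h = -Δf into a pointwise relation between L² functions, on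
which all later computations are made. -/
theorem eq_neg_laplacian_iff (f h : L2 n) :
    (h : 𝓢'(Space, EuclideanSpace ℂ (Fin n))) = -Δ (f : 𝓢'(Space, EuclideanSpace ℂ (Fin n))) ↔
      (𝓕 h : L2 n) =ᵐ[volume] fun ξ => (symbol ξ : ℂ) • (𝓕 f : L2 n) ξ := by
  rw [← toTemperedDistribution_eq_smulLeftCLM_iff hasTemperateGrowth_symbol]
  have h1 : -Δ (f : 𝓢'(Space, EuclideanSpace ℂ (Fin n))) =
      𝓕⁻ (TemperedDistribution.smulLeftCLM (EuclideanSpace ℂ (Fin n))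
        (fun ξ => (symbol ξ : ℂ)) (𝓕 f : L2 n)) := by
    rw [TemperedDistribution.laplacian_eq_fourierMultiplierCLM,
      TemperedDistribution.fourierMultiplierCLM_apply, Lp.fourier_toTemperedDistribution_eq]
    have h2 : (fun ξ : Space => (symbol ξ : ℂ)) =
        ((2 * π) ^ 2 : ℂ) • fun ξ => Complex.ofReal (‖ξ‖ ^ 2) := by
      ext ξ; simp [symbol, mul_pow]
    rw [h2, TemperedDistribution.smulLeftCLM_smul (by fun_prop), neg_smul, neg_neg,
      ← Complex.coe_smul]
    push_cast
    exact (FourierTransform.fourierInv_smul _ _).symm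
  rw [h1]
  constructor
  · intro H
    rw [← Lp.fourier_toTemperedDistribution_eq h, H, FourierTransform.fourier_fourierInv_eq]
  · intro H
    rw [← H, Lp.fourierInv_toTemperedDistribution_eq, FourierTransform.fourierInv_fourier_eq]

theorem fourier_negLaplacian (f : W22 n) :
    (𝓕 (negLaplacian n f) : L2 n) =ᵐ[volume] fun ξ => (symbol ξ : ℂ) • (𝓕 (f : L2 n) : L2 n) ξ := by
  rw [← eq_neg_laplacian_iff]
  exact (exists_neg_laplacian f).choose_spec

theorem mem_W22_of_fourier {f h : L2 n}
    (H : (𝓕 h : L2 n) =ᵐ[volume] fun ξ => (symbol ξ : ℂ) • (𝓕 f : L2 n) ξ) : f ∈ W22 n := by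
  refine TemperedDistribution.memSobolev_iff_exists_smulLeftCLM_fourier.2
    -- This is (1 + |ξ|²) times the transform of f: the symbol is (2π)²|ξ|², hence the factor
    -- (2π)⁻².
    ⟨𝓕 f + ((2 * π) ^ 2 : ℂ)⁻¹ • 𝓕 h, ?_⟩
  rw [Lp.fourier_toTemperedDistribution_eq, eq_comm, toTemperedDistribution_eq_smulLeftCLM_iff
    (by fun_prop)]
  have hpi : (π : ℂ) ≠ 0 := by exact_mod_cast pi_ne_zero
  filter_upwards [H, Lp.coeFn_add (𝓕 f) (((2 * π) ^ 2 : ℂ)⁻¹ • 𝓕 h),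
    Lp.coeFn_smul ((2 * π) ^ 2 : ℂ)⁻¹ (𝓕 h : L2 n)] with ξ h1 h2 h3
  rw [h2, Pi.add_apply, h3, Pi.smul_apply, h1, smul_smul, add_smul_self]
  congr 1
  simp only [symbol, div_self (two_ne_zero (α := ℝ)), Real.rpow_one]
  push_cast
  field_simp

theorem negLaplacian_eq_of_fourier {f : W22 n} {h : L2 n}
    (H : (𝓕 h : L2 n) =ᵐ[volume] fun ξ => (symbol ξ : ℂ) • (𝓕 (f : L2 n) : L2 n) ξ) :
    negLaplacian n f = h := by
  apply (Lp.fourierTransformₗᵢ Space (EuclideanSpace ℂ (Fin n))).injective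
  exact Lp.ext ((fourier_negLaplacian f).trans H.symm)

/-- Plancherel, together with the symbol being real. -/
theorem inner_negLaplacian_left (f g : W22 n) :
    inner ℂ (negLaplacian n f) (g : L2 n) = inner ℂ (f : L2 n) (negLaplacian n g) := by
  rw [← Lp.inner_fourier_eq, ← Lp.inner_fourier_eq (f : L2 n), L2.inner_def, L2.inner_def]
  refine integral_congr_ae ?_
  filter_upwards [fourier_negLaplacian f, fourier_negLaplacian g] with ξ h1 h2
  rw [h1, h2, inner_smul_left, inner_smul_right, Complex.conj_ofReal]

/-- With t = 2π|ξ| the expression factors as (κ + it)(κ - it), and both factors have real part Re κ.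
The bound makes the resolvent multiplier bounded. -/
theorem sq_re_le_norm_symbol_add {κ : ℂ} (hκ : 0 < κ.re) (ξ : Space) :
    κ.re ^ 2 ≤ ‖(symbol ξ : ℂ) + κ ^ 2‖ := by
  set t : ℝ := 2 * π * ‖ξ‖ with ht
  have h1 : (symbol ξ : ℂ) + κ ^ 2 = (κ + t * Complex.I) * (κ - t * Complex.I) := by
    have : symbol ξ = t ^ 2 := rfl
    rw [this]
    push_cast
    linear_combination (t : ℂ) ^ 2 * Complex.I_sq
  have h2 : κ.re ≤ ‖κ + t * Complex.I‖ := by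
    simpa using (Complex.re_le_norm (κ + t * Complex.I))
  have h3 : κ.re ≤ ‖κ - t * Complex.I‖ := by
    simpa using (Complex.re_le_norm (κ - t * Complex.I))
  rw [h1, norm_mul, sq]
  exact mul_le_mul h2 h3 hκ.le (norm_nonneg _)

theorem symbol_add_ne_zero {κ : ℂ} (hκ : 0 < κ.re) (ξ : Space) : (symbol ξ : ℂ) + κ ^ 2 ≠ 0 := by
  intro h
  have := sq_re_le_norm_symbol_add hκ ξ
  rw [h, norm_zero] at this
  nlinarith

theorem memLp_top_inv_symbol_add {κ : ℂ} (hκ : 0 < κ.re) :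
    MemLp (fun ξ => ((symbol ξ : ℂ) + κ ^ 2)⁻¹) ∞ (volume : Measure Space) := by
  refine memLp_top_of_bound (Continuous.aestronglyMeasurable ?_) (κ.re ^ 2)⁻¹
    (ae_of_all _ fun ξ => ?_)
  · exact ((Complex.continuous_ofReal.comp continuous_symbol).add continuous_const).inv₀
      (symbol_add_ne_zero hκ)
  · rw [norm_inv]
    exact inv_anti₀ (by positivity) (sq_re_le_norm_symbol_add hκ ξ)

/-- The resolvent of `-Δ` at the point `-κ²`, for `Re κ > 0`. -/
def freeResolvent (n : ℕ) {κ : ℂ} (hκ : 0 < κ.re) : L2 n →L[ℂ] L2 n :=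
  (Lp.fourierTransformₗᵢ Space (EuclideanSpace ℂ (Fin n))).symm.toContinuousLinearEquiv ∘L
    ((ContinuousLinearMap.lsmul ℂ ℂ).holderL volume ∞ 2 2 (memLp_top_inv_symbol_add hκ).toLp) ∘L
      (Lp.fourierTransformₗᵢ Space (EuclideanSpace ℂ (Fin n))).toContinuousLinearEquiv.toContinuousLinearMap

theorem fourier_freeResolvent {κ : ℂ} (hκ : 0 < κ.re) (w : L2 n) :
    (𝓕 (freeResolvent n hκ w) : L2 n) =ᵐ[volume]
      fun ξ => ((symbol ξ : ℂ) + κ ^ 2)⁻¹ • (𝓕 w : L2 n) ξ := by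
  have h1 : (𝓕 (freeResolvent n hκ w) : L2 n) = (ContinuousLinearMap.lsmul ℂ ℂ).holder 2
      (memLp_top_inv_symbol_add hκ).toLp (𝓕 w : L2 n) := by
    exact (Lp.fourierTransformₗᵢ Space (EuclideanSpace ℂ (Fin n))).apply_symm_apply _
  rw [h1]
  filter_upwards [(ContinuousLinearMap.lsmul ℂ ℂ).coeFn_holder (r := 2)
    (memLp_top_inv_symbol_add hκ).toLp (𝓕 w : L2 n),
    (memLp_top_inv_symbol_add hκ).coeFn_toLp] with ξ h2 h3
  rw [h2, h3]
  rfl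

theorem fourier_smul_add {f g : L2 n} (c : ℂ) :
    (𝓕 (f + c • g) : L2 n) =ᵐ[volume] fun ξ => (𝓕 f : L2 n) ξ + c • (𝓕 g : L2 n) ξ := by
  rw [FourierTransform.fourier_add, FourierTransform.fourier_smul]
  filter_upwards [Lp.coeFn_add (𝓕 f : L2 n) (c • 𝓕 g : L2 n), Lp.coeFn_smul c (𝓕 g : L2 n)]
    with ξ h1 h2
  rw [h1, Pi.add_apply, h2, Pi.smul_apply]

theorem fourier_sub_smul_freeResolvent {κ : ℂ} (hκ : 0 < κ.re) (w : L2 n) :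
    (𝓕 (w + (-κ ^ 2) • freeResolvent n hκ w) : L2 n) =ᵐ[volume]
      fun ξ => (symbol ξ : ℂ) • (𝓕 (freeResolvent n hκ w) : L2 n) ξ := by
  filter_upwards [fourier_smul_add (f := w) (g := freeResolvent n hκ w) (-κ ^ 2),
    fourier_freeResolvent hκ w] with ξ h1 h2
  rw [h1, h2, smul_smul, smul_smul, add_smul_self]
  congr 1
  have := symbol_add_ne_zero hκ ξ
  field_simp
  ring

theorem freeResolvent_mem {κ : ℂ} (hκ : 0 < κ.re) (w : L2 n) : freeResolvent n hκ w ∈ W22 n :=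
  mem_W22_of_fourier (fourier_sub_smul_freeResolvent hκ w)

theorem negLaplacian_freeResolvent {κ : ℂ} (hκ : 0 < κ.re) (w : L2 n) :
    negLaplacian n ⟨freeResolvent n hκ w, freeResolvent_mem hκ w⟩ + κ ^ 2 • freeResolvent n hκ w =
      w := by
  rw [negLaplacian_eq_of_fourier (f := ⟨freeResolvent n hκ w, freeResolvent_mem hκ w⟩)
    (fourier_sub_smul_freeResolvent hκ w), neg_smul, neg_add_cancel_right]

theorem freeResolvent_negLaplacian {κ : ℂ} (hκ : 0 < κ.re) (f : W22 n) :
    freeResolvent n hκ (negLaplacian n f + κ ^ 2 • (f : L2 n)) = f := by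
  apply (Lp.fourierTransformₗᵢ Space (EuclideanSpace ℂ (Fin n))).injective
  refine Lp.ext ((fourier_freeResolvent hκ _).trans ?_)
  filter_upwards [fourier_smul_add (f := negLaplacian n f) (g := (f : L2 n)) (κ ^ 2),
    fourier_negLaplacian f] with ξ h1 h2
  rw [h1, h2, ← add_smul, smul_smul, inv_mul_cancel₀ (symbol_add_ne_zero hκ ξ), one_smul]
  rfl

/-- Sobolev embedding in dimension three: the order 2 exceeds 3/2, which makes the transform
integrable and the function continuous. -/
theorem integrable_fourier (f : W22 n) : Integrable (𝓕 (f : L2 n) : L2 n) := by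
  obtain ⟨v, hv⟩ := TemperedDistribution.MemSobolev.fourier_memL1 (s := 2)
    (by simp; norm_num) f.2
  have hvi : Integrable v := L1.integrable_coeFn v
  refine hvi.congr (ae_eq_of_integral_schwartz_smul_eq hvi.locallyIntegrable
    (locallyIntegrable_Lp _) fun φ => ?_)
  rw [← Lp.toTemperedDistribution_apply, ← Lp.toTemperedDistribution_apply, ← hv,
    Lp.fourier_toTemperedDistribution_eq]

/-- The continuous representative of an element of `W²₂`. -/
def contRep (f : W22 n) : Space → EuclideanSpace ℂ (Fin n) :=
  𝓕⁻ ((𝓕 (f : L2 n) : L2 n) : Space → EuclideanSpace ℂ (Fin n))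

theorem continuous_contRep (f : W22 n) : Continuous (contRep f) :=
  continuous_fourierInv_of_integrable (integrable_fourier f)

theorem coeFn_ae_eq_contRep (f : W22 n) : (f : L2 n) =ᵐ[volume] contRep f := by
  have h := coeFn_fourierInv_of_integrable _ (integrable_fourier f)
  rwa [FourierTransform.fourierInv_fourier_eq] at h

theorem memLp_yukawa_smul {κ : ℂ} (hκ : 0 < κ.re) (x : Space) (a : EuclideanSpace ℂ (Fin n)) :
    MemLp (fun y => yukawa κ (y - x) • a) 2 := by
  have h := (memLp_yukawa hκ).comp_measurePreserving (measurePreserving_sub_right volume x)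
  exact (ContinuousLinearMap.toSpanSingleton ℂ a).comp_memLp' h

theorem integrable_yukawa_smul {κ : ℂ} (hκ : 0 < κ.re) (x : Space) (a : EuclideanSpace ℂ (Fin n)) :
    Integrable (fun y => yukawa κ (y - x) • a) :=
  ((integrable_yukawa hκ).comp_sub_right x).smul_const a

/-- The `L²` function `y ↦ e^{-κ|y - x|} / (4π|y - x|) a`. -/
def greenFun {κ : ℂ} (hκ : 0 < κ.re) (x : Space) (a : EuclideanSpace ℂ (Fin n)) : L2 n :=
  (memLp_yukawa_smul hκ x a).toLp

theorem coeFn_greenFun {κ : ℂ} (hκ : 0 < κ.re) (x : Space) (a : EuclideanSpace ℂ (Fin n)) :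
    greenFun hκ x a =ᵐ[volume] fun y => yukawa κ (y - x) • a :=
  (memLp_yukawa_smul hκ x a).coeFn_toLp

/-- Translation to the centre x contributes the phase; the rest is the transform of the Yukawa
potential. -/
theorem fourier_greenFun {κ : ℂ} (hκ : 0 < κ.re) (x : Space) (a : EuclideanSpace ℂ (Fin n)) :
    (𝓕 (greenFun hκ x a) : L2 n) =ᵐ[volume] fun ξ =>
      (Complex.exp (((-2 * π * inner ℝ x ξ : ℝ) : ℂ) * Complex.I) *
        ((symbol ξ : ℂ) + κ ^ 2)⁻¹) • a := by
  have hint : Integrable (greenFun hκ x a) :=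
    (integrable_yukawa_smul hκ x a).congr (coeFn_greenFun hκ x a).symm
  refine (coeFn_fourier_of_integrable _ hint).trans (ae_of_all _ fun ξ => ?_)
  dsimp only
  rw [Real.fourier_congr_ae (coeFn_greenFun hκ x a), Real.fourier_eq',
    ← integral_add_right_eq_self _ x]
  simp_rw [add_sub_cancel_right, smul_smul]
  rw [integral_smul_const]
  congr 1
  have h := fourier_yukawa hκ ξ
  rw [Real.fourier_eq'] at h
  rw [symbol, ← h, ← integral_const_mul]
  refine integral_congr_ae (ae_of_all _ fun v => ?_)
  dsimp only
  rw [smul_eq_mul, ← mul_assoc, ← Complex.exp_add, inner_add_left]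
  congr 2
  push_cast
  ring

/-- The Green function reproduces point values: `((-Δ - z)f, G_{z̄}(· - x)a) = (f(x), a)`. -/
theorem inner_greenFun {κ : ℂ} (hκ : 0 < κ.re) (x : Space) (a : EuclideanSpace ℂ (Fin n))
    (f : W22 n) :
    inner ℂ (greenFun hκ x a) (negLaplacian n f + (starRingEnd ℂ κ) ^ 2 • (f : L2 n)) =
      inner ℂ a (contRep f x) := by
  rw [← Lp.inner_fourier_eq, L2.inner_def, contRep, Real.fourierInv_eq', ← integral_inner]
  · refine integral_congr_ae ?_
    filter_upwards [fourier_greenFun hκ x a,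
      fourier_smul_add (f := negLaplacian n f) (g := (f : L2 n)) (starRingEnd ℂ κ ^ 2),
      fourier_negLaplacian f] with ξ h1 h2 h3
    rw [h1, h2, h3, ← add_smul, inner_smul_left, inner_smul_right, inner_smul_right, ← mul_assoc]
    congr 1
    -- Conjugating the first argument of the inner product turns κ² into its conjugate, so the two
    -- factors cancel.
    have h0 : (symbol ξ : ℂ) + starRingEnd ℂ κ ^ 2 ≠ 0 :=
      symbol_add_ne_zero (κ := starRingEnd ℂ κ) (by simpa using hκ) ξ
    rw [map_mul, map_inv₀, map_add, map_pow, Complex.conj_ofReal, mul_assoc, inv_mul_cancel₀ h0,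
      mul_one, ← Complex.exp_conj, map_mul, Complex.conj_ofReal, Complex.conj_I, real_inner_comm]
    congr 1
    push_cast
    ring
  · refine (integrable_fourier f).bdd_smul (φ := fun v => Complex.exp
      (((2 * π * inner ℝ v x : ℝ) : ℂ) * Complex.I)) 1
      (Continuous.aestronglyMeasurable (by fun_prop)) (ae_of_all _ fun v => ?_)
    rw [Complex.norm_exp_ofReal_mul_I]

end FreeOperator

/-! ### Boundary values at the points x_j -/

section BoundaryValues

variable {m n : ℕ}

theorem greenFun_add {κ : ℂ} (hκ : 0 < κ.re) (x : Space) (a b : EuclideanSpace ℂ (Fin n)) :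
    greenFun hκ x (a + b) = greenFun hκ x a + greenFun hκ x b := by
  rw [greenFun, greenFun, greenFun, ← MemLp.toLp_add]
  congr 1
  ext1 y
  exact smul_add _ _ _

theorem greenFun_smul {κ : ℂ} (hκ : 0 < κ.re) (x : Space) (c : ℂ) (a : EuclideanSpace ℂ (Fin n)) :
    greenFun hκ x (c • a) = c • greenFun hκ x a := by
  rw [greenFun, greenFun, ← MemLp.toLp_const_smul]
  congr 1
  ext1 y
  exact smul_comm _ _ _

/-- The superposition `∑ⱼ G(· - xⱼ) ξⱼ` of Green functions centred at the points `xⱼ`. -/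
def greenMap {κ : ℂ} (hκ : 0 < κ.re) (x : Fin m → Space) : BoundarySpace m n →ₗ[ℂ] L2 n where
  toFun ξ := ∑ j, greenFun hκ (x j) (ξ j)
  map_add' ξ η := by simp [greenFun_add, Finset.sum_add_distrib]
  map_smul' c ξ := by simp [greenFun_smul, Finset.smul_sum]

theorem greenMap_apply {κ : ℂ} (hκ : 0 < κ.re) (x : Fin m → Space) (ξ : BoundarySpace m n) :
    greenMap hκ x ξ = ∑ j, greenFun hκ (x j) (ξ j) := rfl

theorem coeFn_greenMap {κ : ℂ} (hκ : 0 < κ.re) (x : Fin m → Space) (ξ : BoundarySpace m n) :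
    greenMap hκ x ξ =ᵐ[volume] fun y => ∑ j, yukawa κ (y - x j) • ξ j := by
  rw [greenMap_apply]
  have h : ∀ᵐ y, ∀ j, greenFun hκ (x j) (ξ j) y = yukawa κ (y - x j) • ξ j :=
    ae_all_iff.2 fun j => coeFn_greenFun hκ (x j) (ξ j)
  filter_upwards [h, Lp.coeFn_finsetSum Finset.univ fun j => greenFun hκ (x j) (ξ j)] with y h1 h2
  rw [h2, Finset.sum_apply]
  exact Finset.sum_congr rfl fun j _ => h1 j

/-- The values at the points `xⱼ` of the continuous representative. -/
def pointValues (x : Fin m → Space) (f : W22 n) : BoundarySpace m n :=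
  WithLp.toLp 2 fun j => contRep f (x j)

theorem inner_greenMap {κ : ℂ} (hκ : 0 < κ.re) (x : Fin m → Space) (ξ : BoundarySpace m n)
    (f : W22 n) :
    inner ℂ (greenMap hκ x ξ) (negLaplacian n f + (starRingEnd ℂ κ) ^ 2 • (f : L2 n)) =
      inner ℂ ξ (pointValues x f) := by
  rw [greenMap_apply, sum_inner, PiLp.inner_apply]
  exact Finset.sum_congr rfl fun j _ => inner_greenFun hκ (x j) (ξ j) f

/-- Continuous functions that agree almost everywhere agree everywhere, so the representative in the
definition must be `contRep f`. -/
theorem mem_minimalDomain_iff {x : Fin m → Space} (f : W22 n) :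
    (f : L2 n) ∈ minimalDomain n x ↔ pointValues x f = 0 := by
  constructor
  · rintro ⟨-, u, hu, hfu, hux⟩
    have h : u = contRep f := (hu.ae_eq_iff_eq volume (continuous_contRep f)).1
      (hfu.symm.trans (coeFn_ae_eq_contRep f))
    ext1 j
    exact (congrFun h (x j)).symm.trans (hux j)
  · intro h
    exact ⟨f.2, contRep f, continuous_contRep f, coeFn_ae_eq_contRep f,
      fun j => congrArg (fun η : BoundarySpace m n => η j) h⟩

theorem yukawa_neg (κ : ℂ) (y : Space) : yukawa κ (-y) = yukawa κ y := by
  rw [yukawa, yukawa, norm_neg]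

theorem continuousAt_yukawa (κ : ℂ) {y : Space} (hy : y ≠ 0) : ContinuousAt (yukawa κ) y := by
  unfold yukawa
  refine ContinuousAt.div (by fun_prop) (by fun_prop) ?_
  simp [hy, Real.pi_ne_zero]

/-- The difference is the slope of e^{-κr} at r = 0 divided by 4π. Its limit is the diagonal entry
of the Weyl matrix. -/
theorem tendsto_yukawa_sub (κ : ℂ) :
    Tendsto (fun y : Space => yukawa κ y - (‖y‖ : ℂ)⁻¹ * (4 * Real.pi : ℂ)⁻¹) (𝓝[≠] 0)
      (𝓝 (-κ / (4 * Real.pi))) := by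
  have hd : HasDerivAt (fun r : ℝ => Complex.exp (-κ * r)) (-κ) 0 := by
    have h := ((Complex.ofRealCLM.hasDerivAt (x := 0)).const_mul (-κ)).cexp
    simpa using h
  have hn : Tendsto (fun y : Space => ‖y‖) (𝓝[≠] 0) (𝓝[≠] 0) := by
    refine tendsto_nhdsWithin_iff.2 ⟨?_, ?_⟩
    · exact (continuous_norm.tendsto' 0 0 norm_zero).mono_left nhdsWithin_le_nhds
    · filter_upwards [self_mem_nhdsWithin] with y hy
      simpa using hy
  have h := (hd.tendsto_slope_zero.comp hn).div_const (4 * Real.pi : ℂ)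
  refine h.congr fun y => ?_
  simp only [Function.comp_apply, zero_add, yukawa, Complex.ofReal_zero, mul_zero,
    Complex.exp_zero, Complex.real_smul, Complex.ofReal_inv]
  rw [div_eq_mul_inv, div_eq_mul_inv, mul_inv]
  ring

/-- The Weyl matrix at `-κ²` applied to a vector. -/
def weylVec (κ : ℂ) (x : Fin m → Space) (ξ : BoundarySpace m n) : BoundarySpace m n :=
  WithLp.toLp 2 fun j => (-κ / (4 * Real.pi)) • ξ j + ∑ k, yukawa κ (x j - x k) • ξ k

theorem hasBoundaryValues_add_greenMap {κ : ℂ} (hκ : 0 < κ.re) {x : Fin m → Space}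
    (hx : Function.Injective x) (f : W22 n) (ξ : BoundarySpace m n) :
    HasBoundaryValues x ((f : L2 n) + greenMap hκ x ξ) ξ (pointValues x f + weylVec κ x ξ) := by
  refine ⟨fun y => contRep f y + ∑ k, yukawa κ (y - x k) • ξ k, ?_, ?_,
    fun j => (4 * Real.pi : ℝ)⁻¹ • ξ j, fun j => ?_⟩
  · filter_upwards [Lp.coeFn_add (f : L2 n) (greenMap hκ x ξ), coeFn_ae_eq_contRep f,
      coeFn_greenMap hκ x ξ] with y h1 h2 h3
    rw [h1, Pi.add_apply, h2, h3]
  · intro y hy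
    refine ContinuousAt.continuousWithinAt ?_
    refine (continuous_contRep f).continuousAt.add (tendsto_finsetSum _ fun k _ => ?_)
    have hne : y - x k ≠ 0 := fun h => hy ⟨k, (sub_eq_zero.1 h).symm⟩
    have h1 : ContinuousAt (fun y => yukawa κ (y - x k)) y :=
      ContinuousAt.comp (f := fun y => y - x k) (continuousAt_yukawa κ hne) (by fun_prop)
    exact h1.smul continuousAt_const
  · have hterm : ∀ k, Tendsto (fun y => yukawa κ (y - x k) • ξ k -
        if k = j then ((‖y - x j‖ : ℂ)⁻¹ * (4 * Real.pi : ℂ)⁻¹) • ξ k else 0) (𝓝[≠] x j)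
        (𝓝 (yukawa κ (x j - x k) • ξ k + if k = j then (-κ / (4 * Real.pi)) • ξ k else 0)) := by
      intro k
      by_cases hk : k = j
      · subst hk
        have hs : Tendsto (fun y : Space => y - x k) (𝓝[≠] x k) (𝓝[≠] 0) := by
          refine tendsto_nhdsWithin_iff.2 ⟨?_, ?_⟩
          · have : Continuous fun y : Space => y - x k := by fun_prop
            exact (this.tendsto' (x k) 0 (sub_self _)).mono_left nhdsWithin_le_nhds
          · filter_upwards [self_mem_nhdsWithin] with y hy
            exact sub_ne_zero.2 hy
        -- Division by zero gives the value 0, so the diagonal term of the sum in `weylVec` drops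
        -- out.
        have h0 : yukawa κ (0 : Space) = 0 := by simp [yukawa]
        simp only [if_true, sub_self, h0, zero_smul, zero_add, ← sub_smul]
        exact ((tendsto_yukawa_sub κ).comp hs).smul_const (ξ k)
      · simp only [if_neg hk, sub_zero, add_zero]
        have hne : x j - x k ≠ 0 := sub_ne_zero.2 fun h => hk (hx h).symm
        have h1 : ContinuousAt (fun y => yukawa κ (y - x k)) (x j) :=
          ContinuousAt.comp (f := fun y => y - x k) (continuousAt_yukawa κ hne) (by fun_prop)
        exact (h1.smul continuousAt_const).mono_left nhdsWithin_le_nhds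
    have h2 : Tendsto (fun y => contRep f y + ∑ k, yukawa κ (y - x k) • ξ k -
        ‖y - x j‖⁻¹ • (4 * Real.pi : ℝ)⁻¹ • ξ j) (𝓝[≠] x j)
        (𝓝 ((pointValues x f + weylVec κ x ξ) j)) := by
      have h3 := (((continuous_contRep f).tendsto (x j)).mono_left
        (nhdsWithin_le_nhds (s := {x j}ᶜ))).add (tendsto_finsetSum Finset.univ fun k _ => hterm k)
      convert! h3 using 1
      · ext1 y
        rw [Finset.sum_sub_distrib, Finset.sum_ite_eq', if_pos (Finset.mem_univ j), add_sub_assoc]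
        congr 2
        rw [smul_smul, ← Complex.coe_smul]
        push_cast
        rfl
      · rw [Finset.sum_add_distrib, Finset.sum_ite_eq', if_pos (Finset.mem_univ j), add_comm
          (∑ k, yukawa κ (x j - x k) • ξ k)]
        rfl
    refine ⟨?_, ?_, h2⟩
    · have hn : Tendsto (fun y => ‖y - x j‖) (𝓝[≠] x j) (𝓝 0) := by
        have : Continuous fun y : Space => ‖y - x j‖ := by fun_prop
        exact (this.tendsto' (x j) 0 (by simp)).mono_left nhdsWithin_le_nhds
      -- The first limit follows from the finite-part limit on multiplying by |y - x_j|, which tends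
      -- to 0.
      have h3 := (hn.smul h2).add_const ((4 * Real.pi : ℝ)⁻¹ • ξ j)
      rw [zero_smul, zero_add] at h3
      refine h3.congr' ?_
      filter_upwards [self_mem_nhdsWithin] with y hy
      have : ‖y - x j‖ ≠ 0 := norm_ne_zero_iff.2 (sub_ne_zero.2 hy)
      rw [smul_sub, smul_smul, mul_inv_cancel₀ this, one_smul, sub_add_cancel]
    · rw [smul_smul, mul_inv_cancel₀ (by positivity), one_smul]

/-- Two representatives that are continuous off the finite set of points agree there, hence in a
punctured neighbourhood of each point, and so have the same limits. -/
theorem HasBoundaryValues.unique {x : Fin m → Space} {f : L2 n} {h₀ h₁ k₀ k₁ : BoundarySpace m n}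
    (h : HasBoundaryValues x f h₀ h₁) (k : HasBoundaryValues x f k₀ k₁) : h₀ = k₀ ∧ h₁ = k₁ := by
  obtain ⟨u, hfu, hu, ξ, hξ⟩ := h
  obtain ⟨v, hfv, hv, η, hη⟩ := k
  have hopen : IsOpen (Set.range x)ᶜ := (Set.finite_range x).isClosed.isOpen_compl
  have heq : Set.EqOn u v (Set.range x)ᶜ :=
    Measure.eqOn_open_of_ae_eq (ae_restrict_of_ae (hfu.symm.trans hfv)) hopen hu hv
  have hev : ∀ j, ∀ᶠ y in 𝓝[≠] x j, u y = v y := by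
    intro j
    have h1 : (Set.range x \ {x j})ᶜ ∈ 𝓝 (x j) :=
      ((Set.finite_range x).subset Set.sdiff_subset).isClosed.isOpen_compl.mem_nhds
        fun h => h.2 rfl
    filter_upwards [mem_nhdsWithin_of_mem_nhds h1, self_mem_nhdsWithin] with y h2 h3
    exact heq fun h4 => h2 ⟨h4, h3⟩
  have hne : ∀ j, (𝓝[≠] x j).NeBot := fun j => Module.punctured_nhds_neBot ℝ Space (x j)
  have hξη : ξ = η := by
    ext1 j
    have := hne j
    refine tendsto_nhds_unique (hξ j).1 ((hη j).1.congr' ?_)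
    filter_upwards [hev j] with y hy
    rw [hy]
  subst hξη
  constructor
  · ext1 j
    rw [(hξ j).2.1, (hη j).2.1]
  · ext1 j
    have := hne j
    refine tendsto_nhds_unique (hξ j).2.2 ((hη j).2.2.congr' ?_)
    filter_upwards [hev j] with y hy
    rw [hy]

theorem HasBoundaryValues.add {x : Fin m → Space} {f g : L2 n} {h₀ h₁ k₀ k₁ : BoundarySpace m n}
    (h : HasBoundaryValues x f h₀ h₁) (k : HasBoundaryValues x g k₀ k₁) :
    HasBoundaryValues x (f + g) (h₀ + k₀) (h₁ + k₁) := by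
  obtain ⟨u, hfu, hu, ξ, hξ⟩ := h
  obtain ⟨v, hgv, hv, η, hη⟩ := k
  refine ⟨u + v, (Lp.coeFn_add f g).trans (hfu.add hgv), hu.add hv, ξ + η, fun j => ⟨?_, ?_, ?_⟩⟩
  · refine ((hξ j).1.add (hη j).1).congr fun y => ?_
    rw [Pi.add_apply, smul_add]
  · rw [PiLp.add_apply, (hξ j).2.1, (hη j).2.1, Pi.add_apply, smul_add]
  · refine ((hξ j).2.2.add (hη j).2.2).congr fun y => ?_
    rw [Pi.add_apply, Pi.add_apply, smul_add, add_sub_add_comm]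

theorem HasBoundaryValues.smul {x : Fin m → Space} {f : L2 n} {h₀ h₁ : BoundarySpace m n}
    (c : ℂ) (h : HasBoundaryValues x f h₀ h₁) : HasBoundaryValues x (c • f) (c • h₀) (c • h₁) := by
  obtain ⟨u, hfu, hu, ξ, hξ⟩ := h
  refine ⟨c • u, (Lp.coeFn_smul c f).trans (hfu.const_smul c), hu.const_smul c, c • ξ,
    fun j => ⟨?_, ?_, ?_⟩⟩
  · refine ((hξ j).1.const_smul c).congr fun y => ?_
    rw [Pi.smul_apply, smul_comm]
  · rw [PiLp.smul_apply, (hξ j).2.1, Pi.smul_apply, smul_comm]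
  · refine ((hξ j).2.2.const_smul c).congr fun y => ?_
    rw [Pi.smul_apply, Pi.smul_apply, smul_sub, smul_comm c]

/-- Read as a pure superposition the function has singular coefficients ξ; read as a W²₂ function it
has none. Uniqueness of boundary values forces ξ = 0. -/
theorem eq_zero_of_greenMap_mem_W22 {κ : ℂ} (hκ : 0 < κ.re) {x : Fin m → Space}
    (hx : Function.Injective x) {ξ : BoundarySpace m n} (h : greenMap hκ x ξ ∈ W22 n) : ξ = 0 := by
  have h1 := hasBoundaryValues_add_greenMap hκ hx 0 ξ
  have h2 := hasBoundaryValues_add_greenMap hκ hx ⟨_, h⟩ 0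
  rw [map_zero, add_zero] at h2
  rw [ZeroMemClass.coe_zero, zero_add] at h1
  exact (h1.unique h2).1

end BoundaryValues

/-! ### The minimal operator, its adjoint and the boundary triplet -/

section MinimalOperator

variable {m n : ℕ} {x : Fin m → Space}

/-- The reference value κ = 1, i.e. z = -1: it is real, so the resolvent and the Weyl matrix there
are symmetric. -/
theorem re_one_pos : 0 < (1 : ℂ).re := by simp

theorem inner_greenMap_one (ξ : BoundarySpace m n) (f : W22 n) :
    inner ℂ (greenMap re_one_pos x ξ) (negLaplacian n f + (f : L2 n)) =
      inner ℂ ξ (pointValues x f) := by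
  simpa using inner_greenMap re_one_pos x ξ f

theorem negLaplacian_freeResolvent_one (w : L2 n) :
    negLaplacian n ⟨freeResolvent n re_one_pos w, freeResolvent_mem re_one_pos w⟩ +
      freeResolvent n re_one_pos w = w := by
  simpa using negLaplacian_freeResolvent re_one_pos w

theorem freeResolvent_one_negLaplacian (f : W22 n) :
    freeResolvent n re_one_pos (negLaplacian n f + (f : L2 n)) = f := by
  simpa using freeResolvent_negLaplacian re_one_pos f

/-- `-Δ + 1` maps the minimal domain onto the orthogonal complement of the Green functions. -/
theorem freeResolvent_mem_minimalDomain_iff (w : L2 n) :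
    freeResolvent n re_one_pos w ∈ minimalDomain n x ↔
      ∀ ξ : BoundarySpace m n, inner ℂ (greenMap re_one_pos x ξ) w = 0 := by
  have h := mem_minimalDomain_iff (x := x) ⟨_, freeResolvent_mem re_one_pos w⟩
  refine h.trans ?_
  have h1 : ∀ ξ : BoundarySpace m n, inner ℂ (greenMap re_one_pos x ξ) w =
      inner ℂ ξ (pointValues x ⟨_, freeResolvent_mem re_one_pos w⟩) := fun ξ => by
    rw [← inner_greenMap_one]
    exact congrArg _ (negLaplacian_freeResolvent_one w).symm
  simp_rw [h1]
  constructor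
  · intro h2 ξ
    rw [h2, inner_zero_right]
  · intro h2
    exact inner_self_eq_zero.1 (h2 _)

/-- The condition places g in the double orthogonal complement of a finite-dimensional space, which
is that space. -/
theorem mem_range_greenMap_of_orthogonal {g : L2 n}
    (h : ∀ w : L2 n, freeResolvent n re_one_pos w ∈ minimalDomain n x → inner ℂ w g = 0) :
    ∃ ξ : BoundarySpace m n, greenMap re_one_pos x ξ = g := by
  have h1 : g ∈ (LinearMap.range (greenMap (n := n) re_one_pos x))ᗮᗮ := by
    rw [Submodule.mem_orthogonal]
    intro w hw
    refine h w ((freeResolvent_mem_minimalDomain_iff w).2 fun ξ => ?_)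
    exact (Submodule.mem_orthogonal _ _).1 hw _ ⟨ξ, rfl⟩
  rw [Submodule.orthogonal_orthogonal] at h1
  exact h1

/-- An element of the minimal domain as an element of `W²₂`. -/
def domainToW22 (v : (minimalOperator n x).domain) : W22 n := ⟨v, minimalDomain_le n x v.2⟩

theorem coe_domainToW22 (v : (minimalOperator n x).domain) : (domainToW22 v : L2 n) = v := rfl

theorem minimalOperator_apply (v : (minimalOperator n x).domain) :
    minimalOperator n x v = negLaplacian n (domainToW22 v) := rfl

theorem pointValues_domainToW22 (v : (minimalOperator n x).domain) :
    pointValues x (domainToW22 v) = 0 :=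
  (mem_minimalDomain_iff (domainToW22 v)).1 v.2

theorem inner_negLaplacian_domain (f : W22 n) (v : (minimalOperator n x).domain) :
    inner ℂ (negLaplacian n f) (v : L2 n) = inner ℂ (f : L2 n) (minimalOperator n x v) := by
  rw [minimalOperator_apply, ← inner_negLaplacian_left, coe_domainToW22]

theorem isClosed_minimalOperator : (minimalOperator n x).IsClosed := by
  -- With R = (-Δ + 1)⁻¹, a pair (f, h) lies in the graph iff f = R(h + f) and h + f is orthogonal
  -- to all Green superpositions. Both conditions are closed.
  have h : ((minimalOperator n x).graph : Set (L2 n × L2 n)) =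
      {p | freeResolvent n re_one_pos (p.2 + p.1) = p.1} ∩
        ⋂ ξ : BoundarySpace m n, {p | inner ℂ (greenMap re_one_pos x ξ) (p.2 + p.1) = 0} := by
    ext ⟨f, h⟩
    simp only [SetLike.mem_coe, LinearPMap.mem_graph_iff, Set.mem_inter_iff, Set.mem_ofPred_eq,
      Set.mem_iInter]
    rw [← freeResolvent_mem_minimalDomain_iff]
    constructor
    · rintro ⟨y, rfl, rfl⟩
      have h1 := freeResolvent_one_negLaplacian (domainToW22 y)
      rw [coe_domainToW22] at h1
      rw [minimalOperator_apply]
      exact ⟨h1, by rw [h1]; exact y.2⟩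
    · rintro ⟨h1, h2⟩
      have h3 := negLaplacian_freeResolvent_one (h + f)
      refine ⟨⟨f, h1 ▸ h2⟩, rfl, ?_⟩
      simp only [h1] at h3
      exact add_right_cancel h3
  rw [LinearPMap.IsClosed, h]
  refine IsClosed.inter (isClosed_eq (by fun_prop) (by fun_prop))
    (isClosed_iInter fun ξ => isClosed_eq (by fun_prop) (by fun_prop))

theorem isFormalAdjoint_minimalOperator :
    (minimalOperator n x).IsFormalAdjoint (minimalOperator n x) := fun f g => by
  rw [minimalOperator_apply f, inner_negLaplacian_domain, coe_domainToW22]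

theorem inner_freeResolvent_one (v w : L2 n) :
    inner ℂ v (freeResolvent n re_one_pos w) = inner ℂ (freeResolvent n re_one_pos v) w := by
  have hv := negLaplacian_freeResolvent_one v
  have hw := negLaplacian_freeResolvent_one w
  conv_lhs => rw [← hv]
  conv_rhs => rw [← hw]
  rw [inner_add_left, inner_add_right]
  exact congrArg (· + _) (inner_negLaplacian_left ⟨_, freeResolvent_mem re_one_pos v⟩
    ⟨_, freeResolvent_mem re_one_pos w⟩)

/-- If f is orthogonal to the domain, then Rf is orthogonal to the range of H + 1, hence a Green
superposition. It is also in W²₂, so it vanishes, and f = (-Δ + 1)Rf = 0. -/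
theorem dense_minimalDomain (hx : Function.Injective x) :
    Dense ((minimalOperator n x).domain : Set (L2 n)) := by
  rw [Submodule.dense_iff_topologicalClosure_eq_top, Submodule.topologicalClosure_eq_top_iff,
    Submodule.eq_bot_iff]
  intro f hf
  rw [Submodule.mem_orthogonal] at hf
  obtain ⟨ξ, hξ⟩ := mem_range_greenMap_of_orthogonal (x := x)
    (g := freeResolvent n re_one_pos f) fun w hw => by
      rw [inner_freeResolvent_one]
      exact hf _ hw
  have hξ0 : ξ = 0 := eq_zero_of_greenMap_mem_W22 re_one_pos hx
    (by rw [hξ]; exact freeResolvent_mem _ _)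
  rw [hξ0, map_zero] at hξ
  have h := negLaplacian_freeResolvent_one f
  simp only [← hξ, add_zero] at h
  rw [← h]
  exact map_zero (negLaplacian n)

/-- Functions in the minimal domain vanish at the points, so the reproducing property makes Green
superpositions eigenvectors of the adjoint for -κ². -/
theorem inner_eq_inner_minimalOperator {κ : ℂ} (hκ : 0 < κ.re) (f : W22 n)
    (ξ : BoundarySpace m n) (v : (minimalOperator n x).domain) :
    inner ℂ (negLaplacian n f - κ ^ 2 • greenMap hκ x ξ) (v : L2 n) =
      inner ℂ ((f : L2 n) + greenMap hκ x ξ) (minimalOperator n x v) := by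
  have h1 : inner ℂ (negLaplacian n f) (v : L2 n) = inner ℂ (f : L2 n) (minimalOperator n x v) :=
    inner_negLaplacian_domain f v
  have h2 := inner_greenMap hκ x ξ (domainToW22 v)
  rw [pointValues_domainToW22, inner_zero_right, ← minimalOperator_apply, coe_domainToW22,
    inner_add_right, inner_smul_right] at h2
  rw [inner_sub_left, inner_add_left, h1, inner_smul_left, map_pow]
  linear_combination -h2

theorem add_greenMap_mem_adjoint_domain {κ : ℂ} (hκ : 0 < κ.re) (f : W22 n)
    (ξ : BoundarySpace m n) :
    (f : L2 n) + greenMap hκ x ξ ∈ (minimalOperator n x).adjoint.domain :=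
  LinearPMap.mem_adjoint_domain_of_exists _
    ⟨_, inner_eq_inner_minimalOperator hκ f ξ⟩

theorem adjoint_add_greenMap (hx : Function.Injective x) {κ : ℂ} (hκ : 0 < κ.re) (f : W22 n)
    (ξ : BoundarySpace m n) :
    (minimalOperator n x).adjoint ⟨_, add_greenMap_mem_adjoint_domain hκ f ξ⟩ =
      negLaplacian n f - κ ^ 2 • greenMap hκ x ξ :=
  LinearPMap.adjoint_apply_eq (dense_minimalDomain hx) _ (inner_eq_inner_minimalOperator hκ f ξ)

/-- Every element of the domain of the adjoint is the sum of a `W²₂` function and a superposition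
of Green functions. -/
theorem exists_eq_add_greenMap (hx : Function.Injective x)
    (f : (minimalOperator n x).adjoint.domain) :
    ∃ (f₀ : W22 n) (ξ : BoundarySpace m n),
      f = ⟨_, add_greenMap_mem_adjoint_domain re_one_pos f₀ ξ⟩ := by
  set h := (minimalOperator n x).adjoint f with hh
  -- `f₀` solves (-Δ + 1)f₀ = (H* + 1)f, so f - f₀ is orthogonal to the range of H + 1.
  let f₀ : W22 n := ⟨freeResolvent n re_one_pos (h + f), freeResolvent_mem re_one_pos _⟩
  have hf₀ : negLaplacian n f₀ + (f₀ : L2 n) = h + f := negLaplacian_freeResolvent_one _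
  obtain ⟨ξ, hξ⟩ := mem_range_greenMap_of_orthogonal (x := x) (g := (f : L2 n) - (f₀ : L2 n)) fun w hw => by
    let v : (minimalOperator n x).domain := ⟨_, hw⟩
    have hv : minimalOperator n x v + (v : L2 n) = w := negLaplacian_freeResolvent_one w
    have h1 : inner ℂ h (v : L2 n) = inner ℂ (f : L2 n) (minimalOperator n x v) :=
      LinearPMap.adjoint_isFormalAdjoint (dense_minimalDomain hx) f v
    have h2 : inner ℂ (negLaplacian n f₀) (v : L2 n) =
        inner ℂ (f₀ : L2 n) (minimalOperator n x v) :=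
      inner_negLaplacian_domain f₀ v
    have h3 := congrArg (fun u => inner ℂ u (v : L2 n)) hf₀
    simp only [inner_add_left] at h3
    rw [inner_eq_zero_symm, ← hv, inner_add_right, inner_sub_left, inner_sub_left]
    linear_combination -h1 + h2 - h3
  refine ⟨f₀, ξ, Subtype.ext ?_⟩
  change (f : L2 n) = f₀ + greenMap re_one_pos x ξ
  rw [hξ, add_sub_cancel]

/-- At κ = 1 the matrix entries are real and depend only on the distances |x_j - x_k|, so the matrix
is Hermitian. -/
theorem inner_weylVec_one (ξ η : BoundarySpace m n) :
    inner ℂ (weylVec 1 x ξ) η = inner ℂ ξ (weylVec 1 x η) := by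
  have hY : ∀ y : Space, starRingEnd ℂ (yukawa 1 y) = yukawa 1 y := by
    intro y
    rw [yukawa, map_div₀, ← Complex.exp_conj]
    simp [Complex.conj_ofNat]
  simp only [PiLp.inner_apply, weylVec, inner_add_left, inner_add_right, sum_inner, inner_sum,
    inner_smul_left, inner_smul_right, hY, Finset.sum_add_distrib]
  congr 1
  · refine Finset.sum_congr rfl fun j _ => ?_
    simp [Complex.conj_ofNat]
  · rw [Finset.sum_comm]
    refine Finset.sum_congr rfl fun j _ => Finset.sum_congr rfl fun k _ => ?_
    rw [← neg_sub, yukawa_neg]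

/-- The adjoint of an injective map out of a finite-dimensional space is onto. -/
theorem exists_forall_inner_map_eq {H K : Type*} [NormedAddCommGroup H] [InnerProductSpace ℂ H]
    [FiniteDimensional ℂ H] [NormedAddCommGroup K] [InnerProductSpace ℂ K] [CompleteSpace K]
    {N : H →ₗ[ℂ] K} (hN : ∀ ξ, N ξ = 0 → ξ = 0) (η : H) :
    ∃ w, ∀ ξ, inner ℂ (N ξ) w = inner ℂ ξ η := by
  have : CompleteSpace H := FiniteDimensional.complete ℂ H
  let T : H →L[ℂ] K := LinearMap.toContinuousLinearMap N
  have hker : (ContinuousLinearMap.adjoint T).rangeᗮ = ⊥ := by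
    rw [ContinuousLinearMap.orthogonal_range, ContinuousLinearMap.adjoint_adjoint,
      Submodule.eq_bot_iff]
    exact hN
  rw [Submodule.orthogonal_eq_bot_iff] at hker
  obtain ⟨w, hw⟩ : η ∈ (ContinuousLinearMap.adjoint T).range := hker ▸ Submodule.mem_top
  refine ⟨w, fun ξ => ?_⟩
  rw [← hw]
  exact (ContinuousLinearMap.adjoint_inner_right T ξ w).symm

/-- Point evaluation composed with R is the adjoint of the Green map, which is injective because the
points are distinct. -/
theorem exists_pointValues_eq (hx : Function.Injective x) (η : BoundarySpace m n) :
    ∃ f : W22 n, pointValues x f = η := by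
  obtain ⟨w, hw⟩ := exists_forall_inner_map_eq (N := greenMap (n := n) re_one_pos x)
    (fun ξ hξ => eq_zero_of_greenMap_mem_W22 re_one_pos hx (hξ ▸ zero_mem _)) η
  refine ⟨⟨_, freeResolvent_mem re_one_pos w⟩, ext_inner_left ℂ fun ξ => ?_⟩
  rw [← inner_greenMap_one, ← hw]
  exact congrArg _ (negLaplacian_freeResolvent_one w)

theorem exists_hasBoundaryValues (hx : Function.Injective x)
    (f : (minimalOperator n x).adjoint.domain) :
    ∃ h : BoundarySpace m n × BoundarySpace m n, HasBoundaryValues x (f : L2 n) h.1 h.2 := by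
  obtain ⟨f₀, ξ, rfl⟩ := exists_eq_add_greenMap hx f
  exact ⟨(_, _), hasBoundaryValues_add_greenMap re_one_pos hx f₀ ξ⟩

/-- The pair of boundary values of an element of the domain of the adjoint. -/
def boundaryMap (hx : Function.Injective x) :
    (minimalOperator n x).adjoint.domain →ₗ[ℂ] BoundarySpace m n × BoundarySpace m n where
  toFun f := (exists_hasBoundaryValues hx f).choose
  map_add' f g := by
    -- Uniqueness of boundary values makes the chosen values additive.
    have h := ((exists_hasBoundaryValues hx f).choose_spec.add
      (exists_hasBoundaryValues hx g).choose_spec).unique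
      (exists_hasBoundaryValues hx (f + g)).choose_spec
    exact (Prod.ext h.1 h.2).symm
  map_smul' c f := by
    have h := ((exists_hasBoundaryValues hx f).choose_spec.smul c).unique
      (exists_hasBoundaryValues hx (c • f)).choose_spec
    exact (Prod.ext h.1 h.2).symm

theorem hasBoundaryValues_boundaryMap (hx : Function.Injective x)
    (f : (minimalOperator n x).adjoint.domain) :
    HasBoundaryValues x (f : L2 n) (boundaryMap hx f).1 (boundaryMap hx f).2 :=
  (exists_hasBoundaryValues hx f).choose_spec

theorem boundaryMap_add_greenMap (hx : Function.Injective x) (f : W22 n)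
    (ξ : BoundarySpace m n) :
    boundaryMap hx ⟨_, add_greenMap_mem_adjoint_domain re_one_pos f ξ⟩ =
      (ξ, pointValues x f + weylVec 1 x ξ) := by
  have h := (hasBoundaryValues_boundaryMap hx
    ⟨_, add_greenMap_mem_adjoint_domain re_one_pos f ξ⟩).unique
    (hasBoundaryValues_add_greenMap re_one_pos hx f ξ)
  exact Prod.ext h.1 h.2

/-- In the decomposition at κ = 1, the W²₂ parts cancel by symmetry of -Δ, the mixed terms give
point values, and the Weyl matrix terms cancel by Hermiticity. -/
theorem green_identity (hx : Function.Injective x) (f g : (minimalOperator n x).adjoint.domain) :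
    inner ℂ ((minimalOperator n x).adjoint f) (g : L2 n) -
        inner ℂ (f : L2 n) ((minimalOperator n x).adjoint g) =
      inner ℂ (boundaryMap hx f).2 (boundaryMap hx g).1 -
        inner ℂ (boundaryMap hx f).1 (boundaryMap hx g).2 := by
  obtain ⟨f, ξ, rfl⟩ := exists_eq_add_greenMap hx f
  obtain ⟨g, η, rfl⟩ := exists_eq_add_greenMap hx g
  rw [boundaryMap_add_greenMap, boundaryMap_add_greenMap, adjoint_add_greenMap hx,
    adjoint_add_greenMap hx]
  have h1 := inner_negLaplacian_left f g
  have h2 := inner_greenMap_one (x := x) ξ g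
  have h3 := congrArg (starRingEnd ℂ) (inner_greenMap_one (x := x) η f)
  rw [inner_conj_symm, inner_conj_symm] at h3
  have h4 := inner_weylVec_one (x := x) ξ η
  simp only [inner_add_left, inner_add_right, inner_sub_left, inner_sub_right, one_pow,
    one_smul] at h2 h3 ⊢
  linear_combination h1 - h2 + h3 - h4

/-- The boundary triplet of point values. -/
def pointTriplet (n : ℕ) (hx : Function.Injective x) :
    BoundaryTriplet (minimalOperator n x) (BoundarySpace m n) where
  dense_domain := dense_minimalDomain hx
  isClosed := isClosed_minimalOperator
  symmetric := isFormalAdjoint_minimalOperator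
  Γ₀ := LinearMap.fst ℂ _ _ ∘ₗ boundaryMap hx
  Γ₁ := LinearMap.snd ℂ _ _ ∘ₗ boundaryMap hx
  green := green_identity hx
  surjective := by
    rintro ⟨ξ, η⟩
    -- The Green part realises Γ₀ = ξ and already adds `weylVec 1 x ξ` to Γ₁; the W²₂ part supplies
    -- the difference.
    obtain ⟨f, hf⟩ := exists_pointValues_eq hx (η - weylVec 1 x ξ)
    refine ⟨⟨_, add_greenMap_mem_adjoint_domain re_one_pos f ξ⟩, ?_⟩
    refine (boundaryMap_add_greenMap hx f ξ).trans ?_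
    rw [hf, sub_add_cancel]

theorem isPointTriplet_pointTriplet (n : ℕ) (hx : Function.Injective x) :
    IsPointTriplet x (pointTriplet n hx) :=
  hasBoundaryValues_boundaryMap hx

end MinimalOperator

/-! ### Resolvent set of H₀, γ-field and Weyl function -/

section Weyl

variable {m n : ℕ} {x : Fin m → Space}
  {P : BoundaryTriplet (minimalOperator n x) (BoundarySpace m n)}

/-- Uniqueness of boundary values determines Γ₀ and Γ₁ for an arbitrary point triplet, and for every
κ rather than only κ = 1. -/
theorem IsPointTriplet.apply_add_greenMap (hP : IsPointTriplet x P) (hx : Function.Injective x)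
    {κ : ℂ} (hκ : 0 < κ.re) (f : W22 n) (ξ : BoundarySpace m n) :
    P.Γ₀ ⟨_, add_greenMap_mem_adjoint_domain hκ f ξ⟩ = ξ ∧
      P.Γ₁ ⟨_, add_greenMap_mem_adjoint_domain hκ f ξ⟩ = pointValues x f + weylVec κ x ξ :=
  (hP _).unique (hasBoundaryValues_add_greenMap hκ hx f ξ)

theorem mem_adjoint_domain_of_mem_W22 (f : W22 n) :
    (f : L2 n) ∈ (minimalOperator n x).adjoint.domain := by
  simpa using add_greenMap_mem_adjoint_domain (x := x) re_one_pos f 0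

theorem adjoint_apply_of_mem_W22 (hx : Function.Injective x) (f : W22 n) :
    (minimalOperator n x).adjoint ⟨f, mem_adjoint_domain_of_mem_W22 f⟩ = negLaplacian n f := by
  simpa using adjoint_add_greenMap hx re_one_pos f 0

theorem IsPointTriplet.mem_A₀_domain (hP : IsPointTriplet x P) (hx : Function.Injective x)
    (f : W22 n) : (f : L2 n) ∈ P.A₀.domain := by
  refine ⟨⟨⟨f, mem_adjoint_domain_of_mem_W22 f⟩, ?_, rfl⟩, mem_adjoint_domain_of_mem_W22 f⟩
  have h := (hP.apply_add_greenMap hx re_one_pos f 0).1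
  simpa using h

/-- Γ₀ reads off the coefficients of the Green part, so on its kernel only the W²₂ part remains. -/
theorem IsPointTriplet.mem_W22_of_mem_A₀_domain (hP : IsPointTriplet x P)
    (hx : Function.Injective x) {f : L2 n} (hf : f ∈ P.A₀.domain) : f ∈ W22 n := by
  obtain ⟨⟨u, hu, rfl⟩, -⟩ := hf
  obtain ⟨f₀, ξ, rfl⟩ := exists_eq_add_greenMap hx u
  have h : P.Γ₀ _ = 0 := hu
  rw [(hP.apply_add_greenMap hx re_one_pos f₀ ξ).1] at h
  subst h
  simp

theorem IsPointTriplet.A₀_apply (hP : IsPointTriplet x P) (hx : Function.Injective x)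
    (f : W22 n) : P.A₀ ⟨f, hP.mem_A₀_domain hx f⟩ = negLaplacian n f := by
  rw [← adjoint_apply_of_mem_W22 hx f]
  exact LinearPMap.domRestrict_apply rfl

theorem IsPointTriplet.neg_sq_mem_resolventSet (hP : IsPointTriplet x P)
    (hx : Function.Injective x) {κ : ℂ} (hκ : 0 < κ.re) : -κ ^ 2 ∈ resolventSet P.A₀ := by
  refine ⟨freeResolvent n hκ, fun g => ⟨hP.mem_A₀_domain hx ⟨_, freeResolvent_mem hκ g⟩, ?_⟩,
    fun f => ?_⟩
  · rw [neg_smul, sub_neg_eq_add, hP.A₀_apply hx ⟨_, freeResolvent_mem hκ g⟩]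
    exact negLaplacian_freeResolvent hκ g
  · obtain ⟨f, hf⟩ := f
    have hf' := hP.mem_W22_of_mem_A₀_domain hx hf
    rw [neg_smul, sub_neg_eq_add, hP.A₀_apply hx ⟨f, hf'⟩]
    exact freeResolvent_negLaplacian hκ ⟨f, hf'⟩

theorem greenMap_mem_adjoint_domain {κ : ℂ} (hκ : 0 < κ.re) (ξ : BoundarySpace m n) :
    greenMap hκ x ξ ∈ (minimalOperator n x).adjoint.domain := by
  simpa using add_greenMap_mem_adjoint_domain (x := x) hκ 0 ξ

theorem greenMap_mem_defectSubspace (hx : Function.Injective x) {κ : ℂ} (hκ : 0 < κ.re)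
    (ξ : BoundarySpace m n) :
    (⟨_, greenMap_mem_adjoint_domain hκ ξ⟩ : (minimalOperator n x).adjoint.domain) ∈
      defectSubspace (minimalOperator n x) (-κ ^ 2) := by
  have h := adjoint_add_greenMap hx hκ 0 ξ
  simp only [ZeroMemClass.coe_zero, zero_add, map_zero, zero_sub] at h
  have h2 : (minimalOperator n x).adjoint ⟨_, greenMap_mem_adjoint_domain hκ ξ⟩ -
      (-κ ^ 2) • greenMap hκ x ξ = 0 := by
    rw [h, neg_smul, sub_self]
  exact h2

/-- The Green superposition with coefficients ξ lies in the defect subspace and Γ₀ sends it to ξ;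
γ-field and Weyl function are read off from this. -/
theorem IsPointTriplet.symm_apply (hP : IsPointTriplet x P) (hx : Function.Injective x)
    {κ : ℂ} (hκ : 0 < κ.re) (hz : -κ ^ 2 ∈ resolventSet P.A₀) (ξ : BoundarySpace m n) :
    (LinearEquiv.ofBijective (P.Γ₀Restrict (-κ ^ 2)) (P.bijective_Γ₀Restrict hz)).symm ξ =
      ⟨_, greenMap_mem_defectSubspace hx hκ ξ⟩ := by
  rw [LinearEquiv.symm_apply_eq]
  have h := (hP.apply_add_greenMap hx hκ 0 ξ).1
  simp only [ZeroMemClass.coe_zero, zero_add] at h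
  exact h.symm

theorem IsPointTriplet.gammaField_apply (hP : IsPointTriplet x P) (hx : Function.Injective x)
    {κ : ℂ} (hκ : 0 < κ.re) (hz : -κ ^ 2 ∈ resolventSet P.A₀) (ξ : BoundarySpace m n) :
    P.gammaField (-κ ^ 2) hz ξ = greenMap hκ x ξ :=
  congrArg (fun u : defectSubspace (minimalOperator n x) (-κ ^ 2) =>
    ((u : (minimalOperator n x).adjoint.domain) : L2 n)) (hP.symm_apply hx hκ hz ξ)

theorem pointValues_zero : pointValues x (0 : W22 n) = 0 :=
  (mem_minimalDomain_iff (x := x) (0 : W22 n)).1 (zero_mem _)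

theorem IsPointTriplet.weylFunction_apply (hP : IsPointTriplet x P) (hx : Function.Injective x)
    {κ : ℂ} (hκ : 0 < κ.re) (hz : -κ ^ 2 ∈ resolventSet P.A₀) (ξ : BoundarySpace m n) :
    P.weylFunction (-κ ^ 2) hz ξ = weylVec κ x ξ := by
  have h := (hP.apply_add_greenMap hx hκ 0 ξ).2
  simp only [ZeroMemClass.coe_zero, zero_add, pointValues_zero] at h
  rw [← h]
  exact congrArg (fun u : defectSubspace (minimalOperator n x) (-κ ^ 2) => P.Γ₁ u)
    (hP.symm_apply hx hκ hz ξ)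

theorem exists_sqrt {z : ℂ} (hz : 0 < z.im) :
    ∃ κ : ℂ, 0 < κ.re ∧ z = -κ ^ 2 ∧ Complex.I * sqrtUpper z = -κ := by
  have hz0 : -z ≠ 0 := by
    intro h
    rw [neg_eq_zero.1 h] at hz
    simp at hz
  refine ⟨(-z) ^ (1 / 2 : ℂ), ?_, ?_, ?_⟩
  · have harg : |(-z).arg| < Real.pi := by
      rw [abs_lt]
      refine ⟨Complex.neg_pi_lt_arg _, lt_of_le_of_ne (Complex.arg_le_pi _) fun h => ?_⟩
      have := (Complex.arg_eq_pi_iff.1 h).2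
      simp at this
      exact hz.ne' this
    rw [abs_lt] at harg
    rw [Complex.cpow_def_of_ne_zero hz0, Complex.exp_re]
    have him : (Complex.log (-z) * (1 / 2)).im = (-z).arg / 2 := by
      rw [show (1 / 2 : ℂ) = ((1 / 2 : ℝ) : ℂ) by norm_num, Complex.im_mul_ofReal,
        Complex.log_im]
      ring
    rw [him]
    exact mul_pos (Real.exp_pos _) (Real.cos_pos_of_mem_Ioo ⟨by linarith, by linarith⟩)
  · rw [← Complex.cpow_nat_mul]
    norm_num
  · rw [sqrtUpper, ← mul_assoc, Complex.I_mul_I, neg_one_mul]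

/-- The separate case y = 0 agrees with the value of the quotient under division by zero. -/
theorem greenTilde_eq_yukawa {z κ : ℂ} (h : Complex.I * sqrtUpper z = -κ) (y : Space) :
    greenTilde z y = yukawa κ y := by
  rw [greenTilde, yukawa, h]
  split_ifs with hy
  · simp [hy]
  · rfl

theorem weylVec_apply {z κ : ℂ} (h : Complex.I * sqrtUpper z = -κ) (ξ : BoundarySpace m n)
    (j : Fin m) (s : Fin n) :
    weylVec κ x ξ j s = (weylBlock x z).mulVec (fun k => ξ k s) j := by
  simp only [weylVec, Matrix.mulVec, dotProduct, weylBlock, Matrix.of_apply, h,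
    greenTilde_eq_yukawa h, add_mul, Finset.sum_add_distrib, PiLp.add_apply, PiLp.smul_apply,
    smul_eq_mul, WithLp.ofLp_sum, Finset.sum_apply, mul_ite, mul_one, mul_zero, ite_mul, zero_mul,
    Finset.sum_ite_eq, Finset.mem_univ, if_true]

end Weyl

end PointInteraction

end

theorem proposition4p2 (m n : ℕ) (x : Fin m → PointInteraction.Space)
    (hx : Function.Injective x) :
    (∃ P : PointInteraction.BoundaryTriplet (PointInteraction.minimalOperator n x)
        (PointInteraction.BoundarySpace m n), PointInteraction.IsPointTriplet x P) ∧
    ∀ P : PointInteraction.BoundaryTriplet (PointInteraction.minimalOperator n x)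
        (PointInteraction.BoundarySpace m n), PointInteraction.IsPointTriplet x P →
      ∀ z : ℂ, 0 < z.im →
        ∃ hz : z ∈ PointInteraction.resolventSet P.A₀,
          (∀ (ξ : PointInteraction.BoundarySpace m n) (s : Fin n),
            (fun j => P.weylFunction z hz ξ j s) =
              (PointInteraction.weylBlock x z).mulVec fun k => ξ k s) ∧
          ∀ ξ : PointInteraction.BoundarySpace m n,
            P.gammaField z hz ξ =ᵐ[volume] fun y =>
              ∑ j, (Complex.exp (Complex.I * PointInteraction.sqrtUpper z * ‖y - x j‖) /
                (4 * Real.pi * ‖y - x j‖)) • ξ j := by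
  refine ⟨⟨_, PointInteraction.isPointTriplet_pointTriplet n hx⟩, fun P hP z hz => ?_⟩
  obtain ⟨κ, hκ, hzκ, hsqrt⟩ := PointInteraction.exists_sqrt hz
  subst hzκ
  have hres := hP.neg_sq_mem_resolventSet hx hκ
  refine ⟨hres, fun ξ s => ?_, fun ξ => ?_⟩
  · ext j
    rw [hP.weylFunction_apply hx hκ, PointInteraction.weylVec_apply hsqrt]
  · rw [hP.gammaField_apply hx hκ, hsqrt]
    exact PointInteraction.coeFn_greenMap hκ x ξ
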